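/- For each $n\ge 1$ let $\mathcal G_n=\{G_{ij}\}_{1\le i<j\le n}$ be a centered (jointly) Gaussian field with \[ \mathbb E(G_{ij}G_{kl})=\begin{cases}0 & \text{if } |\{i,j\}\cap\{k,l\}|=0,\\ r & \text{if } |\{i,j\}\cap\{k,l\}|=1,\\ 1 & \text{if } |\{i,j\}\cap\{k,l\}|=2,\end{cases} \] where the parameter $r=r_n\in[0,1/2]$ may depend on $n$. Put \[ c_n=\sqrt{2\log n},\qquad d_n=\sqrt{2\log n}-\frac{\log\log n+\log 4\pi}{2\sqrt{2\log n}} . \] Let $(\zeta_k)_{k\ge1}$ be i.i.d. standard exponential random variables, let $\eta_i=-\log\left(\sum_{k=1}^i\zeta_k\right)$ for $i\ge1$, and let $(Z_{ij})_{1\le i<j<\infty}$ be i.i.d. standard normal random variables independent of $(\zeta_k)_{k\ge1}$. Suppose that $(1-2r_n)\log n\to\lambda\in(0,\infty)$ as $n\to\infty$. Then $\sup_{i<j}\left(\frac{\eta_i+\eta_j}{\sqrt2}+\sqrt{2\lambda}\,Z_{ij}\right)$ is almost surely finite, and as $n\to\infty$ \[ c_n\left(\max_{1\le i<j\le n}G_{ij}-\sqrt2\,d_n\right)\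 \xrightarrow{d}\ \sup_{i<j}\left(\frac{\eta_i+\eta_j}{\sqrt2}+\sqrt{2\lambda}\,Z_{ij}\right)-\sqrt2\,\lambda . \] -/

import Mathlib

open MeasureTheory ProbabilityTheory Filter Topology

noncomputable section

namespace SparseField

/-- The index set of the field `𝒢_n`: the pairs `i < j` of elements of an `n`-element set. -/
abbrev Pair (n : ℕ) : Type := {p : Fin n × Fin n // p.1 < p.2}

/-- The index set of the pairs `i < j` of natural numbers. -/
abbrev NatPair : Type := {p : ℕ × ℕ // p.1 < p.2}

/-- The number `|{i, j} ∩ {k, l}|` of common elements of two pairs. -/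
def overlap {n : ℕ} (p q : Pair n) : ℕ :=
  (({p.1.1, p.1.2} : Finset (Fin n)) ∩ {q.1.1, q.1.2}).card

/-- The sparse equicorrelated covariance: `0`, `r` or `1` according as the two pairs have `0`, `1`
or `2` common elements. -/
def sparseCov (r : ℝ) {n : ℕ} (p q : Pair n) : ℝ :=
  if overlap p q = 0 then 0 else if overlap p q = 1 then r else 1

/-- `G = (G_{ij})_{i < j}` is, under `P`, a centered (jointly) Gaussian field with the sparse
equicorrelated covariance of parameter `r`. -/
structure IsSparseEquicorrelated {n : ℕ} {Ω : Type*} [MeasurableSpace Ω]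
    (G : Pair n → Ω → ℝ) (r : ℝ) (P : Measure Ω) : Prop where
  gaussian : HasGaussianLaw (fun ω p => G p ω) P
  centered : ∀ p, ∫ ω, G p ω ∂P = 0
  covariance : ∀ p q, ∫ ω, G p ω * G q ω ∂P = sparseCov r p q

/-- `max_{i < j} G_{ij}`; a maximum over a finite nonempty set for `n ≥ 2`. -/
def fieldMax {n : ℕ} {Ω : Type*} (G : Pair n → Ω → ℝ) (ω : Ω) : ℝ := ⨆ p, G p ω

/-- `c_n = √(2 log n)`. -/
def cSeq (n : ℕ) : ℝ := √(2 * Real.log n)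

/-- `d_n = √(2 log n) - (log log n + log (4π)) / (2 √(2 log n))`. -/
def dSeq (n : ℕ) : ℝ :=
  √(2 * Real.log n)
    - (Real.log (Real.log n) + Real.log (4 * Real.pi)) / (2 * √(2 * Real.log n))

/-- The points `η_i = - log (ζ_1 + ⋯ + ζ_i)`, with all indices shifted to start at `0`:
`eta ζ i` is minus the logarithm of the sum of the first `i + 1` variables. -/
def eta {Ω : Type*} (ζ : ℕ → Ω → ℝ) (i : ℕ) (ω : Ω) : ℝ :=
  -Real.log (∑ k ∈ Finset.range (i + 1), ζ k ω)

/-- `(η_i + η_j) / √2 + √(2λ) Z_{ij}`. -/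
def perturbed {Ω : Type*} (lam : ℝ) (ζ : ℕ → Ω → ℝ) (Z : NatPair → Ω → ℝ)
    (p : NatPair) (ω : Ω) : ℝ :=
  (eta ζ p.1.1 ω + eta ζ p.1.2 ω) / √2 + √(2 * lam) * Z p ω

end SparseField

end

/-! The covariance is that of $\sqrt r\,(x_i+x_j)+\sqrt{1-2r}\,z_{ij}$ with all $x_i$, $z_{ij}$
independent standard normal: each shared index contributes $r$, and equal pairs receive $1-2r$ more
(`sum_sparseCoeff_mul`). Permuting the $x_i$ amounts to relabelling the $z_{ij}$, which preserves
their law, so the $x_i$ may be replaced by their order statistics without changing the law of the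
maximum.

The decreasing transform $-\log\Phi$ turns the largest normals into the smallest exponentials, and
Rényi's representation writes the latter as $\sum_{j\le i}\zeta_j/(n-j)$ (`lintegral_expPi_renyi`,
`map_sparseMax_eq_renyi`). The same $\zeta$ and $Z$ therefore serve every $n$ as well as the limit,
and convergence in distribution becomes an almost sure statement.

On one path, $n$ times the $i$-th exponential order statistic tends to
$\zeta_0+\dots+\zeta_i=e^{-\eta_i}$, so the normal order statistic, rescaled by $c_n$ and $d_n$,
tends to $\eta_i$ (`tendsto_scaledOrder`). Moreover $\sqrt r\to1/\sqrt2$,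
$c_n\sqrt{1-2r}\to\sqrt{2\lambda}$, and the mismatch of centerings $(2\sqrt r-\sqrt2)c_nd_n$ tends
to $-\sqrt2\lambda$ (`tendsto_centering`).

Passing to the supremum requires domination: the law of large numbers makes the order statistics
decay like $-\frac12\log(i+1)$ (`eventually_scaledOrder_le`), while the noise grows more slowly than
any multiple of $\log(i+1)+\log(j+1)$ (`ae_exists_le_add_mul_logSize`). Only finitely many pairs
then compete. -/

open scoped ENNReal

namespace SparseField

/-! ### Order statistics of exponential samples. -/

section OrderStatistics

/-- A finite product of functions of separate coordinates integrates to the product of the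
integrals. -/
theorem lintegral_fin_prod_eq_prod {n : ℕ} {f : Fin n → ℝ → ℝ≥0∞} (hf : ∀ i, Measurable (f i)) :
    ∫⁻ x : Fin n → ℝ, ∏ i, f i (x i) = ∏ i, ∫⁻ t, f i t := by
  induction n with
  | zero => simp [volume_pi]
  | succ n ih =>
    have h := (volume_preserving_piFinSuccAbove (fun _ : Fin (n + 1) => ℝ) 0).symm
    rw [h.lintegral_map_equiv, Fin.prod_univ_succ, ← ih fun i => hf i.succ,
      ← lintegral_prod_mul (hf 0).aemeasurable
        (Finset.measurable_prod _ fun i _ =>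
          (hf i.succ).comp (measurable_pi_apply i)).aemeasurable]
    refine lintegral_congr fun x => ?_
    simp [Fin.prod_univ_succ, MeasurableEquiv.piFinSuccAbove]

/-- The law of `n` independent standard exponential variables. -/
noncomputable abbrev expPi (n : ℕ) : Measure (Fin n → ℝ) :=
  Measure.pi fun _ => expMeasure 1

instance : IsProbabilityMeasure (expMeasure 1) := isProbabilityMeasure_expMeasure one_pos

theorem measurable_exponentialPDF (r : ℝ) : Measurable (exponentialPDF r) :=
  (measurable_exponentialPDFReal r).ennreal_ofReal

theorem expPi_eq_withDensity_prod (n : ℕ) :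
    expPi n = volume.withDensity fun x => ∏ i, exponentialPDF 1 (x i) := by
  refine Measure.pi_eq fun s hs => ?_
  have hind : ∀ x : Fin n → ℝ, (Set.univ.pi s).indicator
      (fun x => ∏ i, exponentialPDF 1 (x i)) x =
      ∏ i, (s i).indicator (exponentialPDF 1) (x i) := by
    intro x
    by_cases hx : x ∈ Set.univ.pi s
    · rw [Set.indicator_of_mem hx]
      exact Finset.prod_congr rfl fun i _ => (Set.indicator_of_mem (hx i trivial) _).symm
    · rw [Set.indicator_of_notMem hx]
      simp only [Set.mem_pi, not_forall] at hx
      obtain ⟨i, -, hi⟩ := hx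
      exact (Finset.prod_eq_zero (Finset.mem_univ i) (Set.indicator_of_notMem hi _)).symm
  rw [withDensity_apply _ (MeasurableSet.univ_pi hs),
    ← lintegral_indicator (MeasurableSet.univ_pi hs)]
  simp_rw [hind]
  rw [lintegral_fin_prod_eq_prod fun i => (measurable_exponentialPDF 1).indicator (hs i)]
  refine Finset.prod_congr rfl fun i _ => ?_
  rw [lintegral_indicator (hs i), expMeasure, gammaMeasure, withDensity_apply _ (hs i)]
  rfl

/-- The density of `expPi n`. -/
noncomputable def expPiDensity {n : ℕ} (x : Fin n → ℝ) : ℝ≥0∞ :=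
  {x : Fin n → ℝ | ∀ i, 0 < x i}.indicator (fun x => ENNReal.ofReal (Real.exp (-∑ i, x i))) x

theorem ae_coord_ne (n : ℕ) (i j : Fin n) (hij : i ≠ j) : ∀ᵐ x : Fin n → ℝ, x i ≠ x j := by
  let L : (Fin n → ℝ) →ₗ[ℝ] ℝ := LinearMap.proj (R := ℝ) (φ := fun _ => ℝ) i - LinearMap.proj j
  have h := Measure.addHaar_submodule (volume : Measure (Fin n → ℝ)) (LinearMap.ker L) (by
    intro h
    have : (Pi.single i 1 : Fin n → ℝ) ∈ LinearMap.ker L := h ▸ Submodule.mem_top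
    simp [L, hij.symm] at this)
  rw [ae_iff]
  convert h using 2
  ext x
  simp [L, sub_eq_zero]

theorem ae_coord_ne_zero (n : ℕ) : ∀ᵐ x : Fin n → ℝ, ∀ i, x i ≠ 0 := by
  rw [ae_all_iff]
  intro i
  let L : (Fin n → ℝ) →ₗ[ℝ] ℝ := LinearMap.proj i
  have h := Measure.addHaar_submodule (volume : Measure (Fin n → ℝ)) (LinearMap.ker L) (by
    intro h
    have : (Pi.single i 1 : Fin n → ℝ) ∈ LinearMap.ker L := h ▸ Submodule.mem_top
    simp [L] at this)
  rw [ae_iff]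
  convert h using 2
  ext x
  simp [L]

theorem measurableSet_coord_pos (n : ℕ) : MeasurableSet {x : Fin n → ℝ | ∀ i, 0 < x i} := by
  simp only [Set.ofPred_forall]
  exact MeasurableSet.iInter fun i => measurableSet_lt measurable_const (measurable_pi_apply i)

theorem measurable_expPiDensity (n : ℕ) : Measurable (expPiDensity (n := n)) :=
  Measurable.indicator (by fun_prop) (measurableSet_coord_pos n)

/-- The two densities differ only where a coordinate vanishes. Strict positivity is chosen to match
`renyi_lt_iff_pos` exactly. -/
theorem expPi_eq_withDensity (n : ℕ) : expPi n = volume.withDensity expPiDensity := by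
  rw [expPi_eq_withDensity_prod]
  refine withDensity_congr_ae ?_
  filter_upwards [ae_coord_ne_zero n] with x hx
  by_cases h : ∀ i, 0 < x i
  · rw [expPiDensity, Set.indicator_of_mem (by exact h), ← Finset.sum_neg_distrib, Real.exp_sum,
      ENNReal.ofReal_prod_of_nonneg fun i _ => (Real.exp_pos _).le]
    exact Finset.prod_congr rfl fun i _ => by simp [exponentialPDF_of_nonneg (h i).le]
  · rw [expPiDensity, Set.indicator_of_notMem (by exact h)]
    push Not at h
    obtain ⟨i, hi⟩ := h
    exact Finset.prod_eq_zero (Finset.mem_univ i)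
      (exponentialPDF_of_neg (lt_of_le_of_ne hi (hx i)))

theorem expPi_absolutelyContinuous (n : ℕ) : expPi n ≪ volume := by
  rw [expPi_eq_withDensity]
  exact withDensity_absolutelyContinuous _ _

theorem lintegral_expPi {n : ℕ} {F : (Fin n → ℝ) → ℝ≥0∞} (hF : Measurable F) :
    ∫⁻ x, F x ∂expPi n = ∫⁻ x, expPiDensity x * F x := by
  rw [expPi_eq_withDensity, lintegral_withDensity_eq_lintegral_mul _ (measurable_expPiDensity n) hF]
  rfl

theorem measurableSet_strictMono (n : ℕ) : MeasurableSet {x : Fin n → ℝ | StrictMono x} := by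
  simp only [StrictMono, Set.ofPred_forall]
  exact MeasurableSet.iInter fun i => MeasurableSet.iInter fun j => MeasurableSet.iInter fun _ =>
    measurableSet_lt (measurable_pi_apply i) (measurable_pi_apply j)

theorem existsUnique_perm_strictMono {n : ℕ} {x : Fin n → ℝ} (hx : Function.Injective x) :
    ∃! σ : Equiv.Perm (Fin n), StrictMono (x ∘ σ) := by
  refine ⟨Tuple.sort x, (Tuple.monotone_sort x).strictMono_of_injective
    (hx.comp (Tuple.sort x).injective), fun τ hτ => ?_⟩
  have h := Tuple.unique_monotone hτ.monotone (Tuple.monotone_sort x)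
  ext i
  exact congrArg _ (hx (congrFun h i))

theorem lintegral_expPi_comp_perm {n : ℕ} (F : (Fin n → ℝ) → ℝ≥0∞) (σ : Equiv.Perm (Fin n)) :
    ∫⁻ x, F (x ∘ σ) ∂expPi n = ∫⁻ x, F x ∂expPi n := by
  have h := measurePreserving_piCongrLeft (α := fun _ => ℝ)
    (fun _ : Fin n => expMeasure 1) σ.symm
  rw [h.lintegral_map_equiv F]
  refine lintegral_congr fun x => congrArg F ?_
  ext i
  simp [MeasurableEquiv.piCongrLeft, Equiv.piCongrLeft_apply]

/-- A symmetric function integrates to `n!` times its integral over the increasing vectors. -/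
theorem lintegral_expPi_of_symmetric {n : ℕ} {F : (Fin n → ℝ) → ℝ≥0∞} (hF : Measurable F)
    (hsymm : ∀ (σ : Equiv.Perm (Fin n)) x, F (x ∘ σ) = F x) :
    ∫⁻ x, F x ∂expPi n =
      Fintype.card (Equiv.Perm (Fin n)) * ∫⁻ x in {x | StrictMono x}, F x ∂expPi n := by
  have hinj : ∀ᵐ x ∂expPi n, Function.Injective x := by
    refine (expPi_absolutelyContinuous n).ae_le ?_
    have : ∀ᵐ x : Fin n → ℝ, ∀ i j, i ≠ j → x i ≠ x j := by
      simp_rw [ae_all_iff]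
      exact fun i j hij => ae_coord_ne n i j hij
    filter_upwards [this] with x hx i j hij
    by_contra hne
    exact hx i j hne hij
  -- Exactly one permutation sorts a vector with distinct coordinates, so one term of the sum
  -- survives.
  have hsum : ∀ᵐ x ∂expPi n, F x =
      ∑ σ : Equiv.Perm (Fin n), {x | StrictMono x}.indicator F (x ∘ σ) := by
    filter_upwards [hinj] with x hx
    obtain ⟨σ, hσ, huniq⟩ := existsUnique_perm_strictMono hx
    rw [Finset.sum_eq_single σ, Set.indicator_of_mem (by exact hσ), hsymm]
    · exact fun τ _ hτ => Set.indicator_of_notMem (fun h => hτ (huniq τ h)) _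
    · simp
  rw [lintegral_congr_ae hsum, lintegral_finsetSum]
  · simp_rw [lintegral_expPi_comp_perm, lintegral_indicator (measurableSet_strictMono n)]
    simp
  · exact fun σ _ => (hF.indicator (measurableSet_strictMono n)).comp
      (measurable_pi_lambda _ fun i => measurable_pi_apply _)

/-- The matrix of the Rényi representation of the order statistics of `n` exponential variables:
the `i`-th order statistic is `∑ j ≤ i, e j / (n - j)`. -/
noncomputable def renyiMatrix (n : ℕ) : Matrix (Fin n) (Fin n) ℝ :=
  Matrix.of fun i j => if j ≤ i then ((n : ℝ) - j)⁻¹ else 0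

/-- The order statistics `∑ j ≤ i, e j / (n - j)` built from the spacings `e`. -/
noncomputable def renyi (n : ℕ) (e : Fin n → ℝ) (i : Fin n) : ℝ :=
  ∑ j, if j ≤ i then e j / ((n : ℝ) - j) else 0

theorem renyi_eq_mulVec (n : ℕ) (e : Fin n → ℝ) : renyi n e = (renyiMatrix n).mulVec e := by
  ext i
  simp [renyi, renyiMatrix, Matrix.mulVec, dotProduct, ite_mul, div_eq_inv_mul]

theorem natCast_sub_fin_pos {n : ℕ} (j : Fin n) : 0 < (n : ℝ) - j := by
  have : ((j : ℕ) : ℝ) < n := by exact_mod_cast j.2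
  linarith

theorem det_renyiMatrix_ne_zero (n : ℕ) : (renyiMatrix n).det ≠ 0 := by
  rw [Matrix.det_of_isLowerTriangular]
  · refine Finset.prod_ne_zero_iff.2 fun i _ => ?_
    simpa [renyiMatrix] using (natCast_sub_fin_pos i).ne'
  · intro i j hij
    have : i < j := hij
    simp [renyiMatrix, this.not_ge]

@[fun_prop]
theorem measurable_renyi (n : ℕ) : Measurable (renyi n) := by
  refine measurable_pi_lambda _ fun i => Finset.measurable_sum _ fun j _ => ?_
  split_ifs <;> fun_prop

/-- The spacing `e j` enters the $n-j$ entries with $i\ge j$, which cancels its denominator. Hence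
the exponential density is preserved. -/
theorem sum_renyi (n : ℕ) (e : Fin n → ℝ) : ∑ i, renyi n e i = ∑ j, e j := by
  simp only [renyi]
  rw [Finset.sum_comm]
  refine Finset.sum_congr rfl fun j _ => ?_
  rw [← Finset.sum_filter, Finset.sum_const]
  have : Finset.univ.filter (fun i => j ≤ i) = Finset.Ici j := by ext; simp
  rw [this, Fin.card_Ici, nsmul_eq_mul, Nat.cast_sub j.2.le, mul_div_cancel₀]
  exact (natCast_sub_fin_pos j).ne'

/-- Consecutive entries differ by $e_i/(n-i)$, and the first entry is $e_0/n$. -/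
theorem renyi_lt_iff_pos {n : ℕ} (e : Fin n → ℝ) :
    (StrictMono (renyi n e) ∧ ∀ i, 0 < renyi n e i) ↔ ∀ i, 0 < e i := by
  have hterm : ∀ i : Fin n, renyi n e i =
      (∑ j, if j < i then e j / ((n : ℝ) - j) else 0) + e i / ((n : ℝ) - i) := by
    intro i
    have : ∀ j : Fin n, (if j ≤ i then e j / ((n : ℝ) - j) else 0) =
        (if j < i then e j / ((n : ℝ) - j) else 0) +
          (if j = i then e i / ((n : ℝ) - i) else 0) := by
      intro j
      rcases lt_trichotomy j i with h | h | h
      · simp [h, h.le, h.ne]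
      · simp [h]
      · simp [h.not_gt, h.not_ge, h.ne']
    simp [renyi, this, Finset.sum_add_distrib]
  constructor
  · rintro ⟨hmono, hpos⟩ i
    have key : 0 < e i / ((n : ℝ) - i) := by
      rcases Nat.eq_zero_or_pos i.1 with hi | hi
      · have h0 : ∀ j : Fin n, ¬ j < i := fun j hj => by
          have : j.1 < i.1 := hj
          omega
        have := hpos i
        rw [hterm i] at this
        simpa [h0] using this
      · let k : Fin n := ⟨i.1 - 1, by omega⟩
        have hk : k < i := Fin.lt_def.2 (by simp [k]; omega)
        have hle : ∀ j : Fin n, j < i ↔ j ≤ k := fun j => by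
          rw [Fin.lt_def, Fin.le_def]; simp [k]; omega
        have := hmono hk
        rw [hterm i] at this
        simp only [hle] at this
        simp only [renyi] at this
        linarith
    exact (div_pos_iff_of_pos_right (natCast_sub_fin_pos i)).1 key
  · intro h
    have hd : ∀ j, 0 < e j / ((n : ℝ) - j) := fun j => div_pos (h j) (natCast_sub_fin_pos j)
    refine ⟨fun i k hik => ?_, fun i => ?_⟩
    · rw [hterm k]
      refine lt_add_of_le_of_pos (Finset.sum_le_sum fun j _ => ?_) (hd k)
      by_cases hj : j ≤ i
      · simp [hj, hj.trans_lt hik]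
      · simp only [hj, if_false]
        split_ifs
        exacts [(hd j).le, le_rfl]
    · rw [hterm i]
      refine add_pos_of_nonneg_of_pos (Finset.sum_nonneg fun j _ => ?_) (hd i)
      split_ifs
      exacts [(hd j).le, le_rfl]

/-- **Rényi's representation**: `renyi n e` has the law of the increasing rearrangement of `n`
independent exponential variables, as tested on symmetric functions. -/
theorem lintegral_expPi_renyi {n : ℕ} {F : (Fin n → ℝ) → ℝ≥0∞} (hF : Measurable F)
    (hsymm : ∀ (σ : Equiv.Perm (Fin n)) x, F (x ∘ σ) = F x) :
    ∫⁻ x, F (renyi n x) ∂expPi n = ∫⁻ x, F x ∂expPi n := by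
  -- The linear change of variables carries the positive orthant onto the increasing positive
  -- vectors, with a constant Jacobian.
  obtain ⟨K, hK⟩ : ∃ K : ℝ≥0∞, ∀ F : (Fin n → ℝ) → ℝ≥0∞, Measurable F →
      ∫⁻ x, F (renyi n x) ∂expPi n = K * ∫⁻ x in {x | StrictMono x}, F x ∂expPi n := by
    refine ⟨ENNReal.ofReal |(renyiMatrix n).det⁻¹|, fun F hF => ?_⟩
    have hg : Measurable ({x : Fin n → ℝ | StrictMono x}.indicator F) :=
      hF.indicator (measurableSet_strictMono n)
    have hpt : ∀ x, expPiDensity x * F (renyi n x) =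
        expPiDensity (renyi n x) * {x | StrictMono x}.indicator F (renyi n x) := by
      intro x
      by_cases hx : ∀ i, 0 < x i
      · obtain ⟨h1, h2⟩ := (renyi_lt_iff_pos x).2 hx
        rw [Set.indicator_of_mem (by exact h1), expPiDensity, expPiDensity,
          Set.indicator_of_mem (by exact hx), Set.indicator_of_mem (by exact h2), sum_renyi]
      · rw [expPiDensity, Set.indicator_of_notMem (by exact hx), zero_mul, eq_comm, mul_eq_zero]
        rw [← renyi_lt_iff_pos, not_and_or] at hx
        rcases hx with h | h
        · exact Or.inr (Set.indicator_of_notMem (by exact h) _)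
        · exact Or.inl (Set.indicator_of_notMem (by exact h) _)
    rw [← lintegral_indicator (measurableSet_strictMono n), lintegral_expPi hg,
      lintegral_expPi (F := fun x => F (renyi n x)) (hF.comp (measurable_renyi n))]
    simp_rw [hpt]
    have hmap := Real.map_matrix_volume_pi_eq_smul_volume_pi (det_renyiMatrix_ne_zero n)
    have hfun : (⇑(Matrix.toLin' (renyiMatrix n)) : (Fin n → ℝ) → Fin n → ℝ) = renyi n := by
      ext x i
      rw [Matrix.toLin'_apply, renyi_eq_mulVec]
    rw [hfun] at hmap
    rw [← lintegral_map (f := fun y => expPiDensity y * {x | StrictMono x}.indicator F y)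
      ((measurable_expPiDensity n).mul hg) (measurable_renyi n), hmap, lintegral_smul_measure,
      smul_eq_mul]
  -- Testing on the constant 1 identifies `K` with $n!$ without evaluating the determinant.
  have h1 := lintegral_expPi_of_symmetric (n := n) (F := fun _ => 1) measurable_const
    fun _ _ => rfl
  have h2 := hK (fun _ => 1) measurable_const
  rw [lintegral_const, one_mul, measure_univ] at h1 h2
  set c := ∫⁻ x in {x : Fin n → ℝ | StrictMono x}, 1 ∂expPi n
  set N : ℝ≥0∞ := (Fintype.card (Equiv.Perm (Fin n)) : ℝ≥0∞) with hN
  have hKN : K = N := by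
    calc K = K * (N * c) := by rw [← h1, mul_one]
      _ = N * (K * c) := by ring
      _ = N := by rw [← h2, mul_one]
  rw [hK F hF, lintegral_expPi_of_symmetric hF hsymm, hKN]

end OrderStatistics

/-! ### The normal tail and the passage between exponential and normal variables. -/

section GaussianTail

/-- The standard normal density. -/
noncomputable def stdDensity (x : ℝ) : ℝ := (√(2 * Real.pi))⁻¹ * Real.exp (-x ^ 2 / 2)

/-- The standard normal distribution function. -/
noncomputable def stdCDF (x : ℝ) : ℝ := cdf (gaussianReal 0 1) x

theorem gaussianPDFReal_zero_one : gaussianPDFReal 0 1 = stdDensity := by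
  ext x
  simp [gaussianPDFReal, stdDensity]

theorem stdDensity_pos (x : ℝ) : 0 < stdDensity x := by
  rw [← gaussianPDFReal_zero_one]
  exact gaussianPDFReal_pos _ _ _ one_ne_zero

theorem continuous_stdDensity : Continuous stdDensity := by
  unfold stdDensity
  fun_prop

theorem integrable_stdDensity : Integrable stdDensity := by
  rw [← gaussianPDFReal_zero_one]
  exact integrable_gaussianPDFReal _ _

theorem stdCDF_eq_integral (x : ℝ) : stdCDF x = ∫ t in Set.Iic x, stdDensity t := by
  rw [stdCDF, cdf_eq_real, measureReal_def, gaussianReal_apply_eq_integral _ one_ne_zero,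
    gaussianPDFReal_zero_one, ENNReal.toReal_ofReal]
  exact integral_nonneg fun t => (stdDensity_pos t).le

theorem hasDerivAt_stdCDF (x : ℝ) : HasDerivAt stdCDF (stdDensity x) x := by
  have h : stdCDF = fun x => stdCDF 0 + ∫ t in (0 : ℝ)..x, stdDensity t := by
    ext y
    rw [stdCDF_eq_integral, stdCDF_eq_integral, ← intervalIntegral.integral_Iic_sub_Iic
      integrable_stdDensity.integrableOn integrable_stdDensity.integrableOn]
    ring
  rw [h]
  exact (intervalIntegral.integral_hasDerivAt_right
    integrable_stdDensity.intervalIntegrable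
    continuous_stdDensity.stronglyMeasurable.stronglyMeasurableAtFilter
    continuous_stdDensity.continuousAt).const_add _

theorem isOpenPosMeasure_gaussianReal : (gaussianReal 0 1).IsOpenPosMeasure :=
  (gaussianReal_absolutelyContinuous' 0 one_ne_zero).isOpenPosMeasure

theorem stdCDF_pos (x : ℝ) : 0 < stdCDF x := by
  have := isOpenPosMeasure_gaussianReal
  rw [stdCDF, cdf_eq_real]
  refine lt_of_lt_of_le ?_ (measureReal_mono Set.Iio_subset_Iic_self)
  exact ENNReal.toReal_pos (isOpen_Iio.measure_pos _ Set.nonempty_Iio).ne' (measure_ne_top _ _)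

theorem stdCDF_add_Ioi (x : ℝ) : stdCDF x + (gaussianReal 0 1).real (Set.Ioi x) = 1 := by
  rw [stdCDF, cdf_eq_real, ← Set.compl_Iic, measureReal_add_measureReal_compl measurableSet_Iic]
  simp

theorem stdCDF_lt_one (x : ℝ) : stdCDF x < 1 := by
  have := isOpenPosMeasure_gaussianReal
  have h : 0 < (gaussianReal 0 1).real (Set.Ioi x) :=
    ENNReal.toReal_pos (isOpen_Ioi.measure_pos _ Set.nonempty_Ioi).ne' (measure_ne_top _ _)
  linarith [stdCDF_add_Ioi x]

/-- The transform `-log Φ` that maps a standard normal variable to a standard exponential one. -/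
noncomputable def expScale (x : ℝ) : ℝ := -Real.log (stdCDF x)

theorem expScale_pos (x : ℝ) : 0 < expScale x :=
  neg_pos.2 (Real.log_neg (stdCDF_pos x) (stdCDF_lt_one x))

theorem hasDerivAt_expScale (x : ℝ) : HasDerivAt expScale (-(stdDensity x / stdCDF x)) x :=
  ((hasDerivAt_stdCDF x).log (stdCDF_pos x).ne').neg

theorem continuous_expScale : Continuous expScale :=
  continuous_iff_continuousAt.2 fun x => (hasDerivAt_expScale x).continuousAt

theorem antitone_expScale : Antitone expScale := fun x _ hxy =>
  neg_le_neg (Real.log_le_log (stdCDF_pos x) (monotone_cdf _ hxy))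

theorem tendsto_stdCDF_atTop : Tendsto stdCDF atTop (𝓝 1) := tendsto_cdf_atTop _

theorem tendsto_expScale_atTop : Tendsto expScale atTop (𝓝 0) := by
  simpa using! (tendsto_stdCDF_atTop.log one_ne_zero).neg

theorem tendsto_expScale_atBot : Tendsto expScale atBot atTop := by
  refine tendsto_neg_atBot_atTop.comp (Real.tendsto_log_nhdsGT_zero.comp ?_)
  exact tendsto_nhdsWithin_iff.2
    ⟨tendsto_cdf_atBot _, Eventually.of_forall fun x => stdCDF_pos x⟩

/-- The inverse of `expScale`, which maps a standard exponential variable to a standard normal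
one. -/
noncomputable def normalOfExp (e : ℝ) : ℝ := sSup {x | e ≤ expScale x}

/-- The set is nonempty, closed and bounded above because `expScale` decreases continuously from
$+\infty$ to 0. This equivalence stands in for the inverse identities. -/
theorem le_normalOfExp_iff {e : ℝ} (he : 0 < e) (x : ℝ) :
    x ≤ normalOfExp e ↔ e ≤ expScale x := by
  have hne : {x | e ≤ expScale x}.Nonempty :=
    (tendsto_expScale_atBot.eventually_ge_atTop e).exists
  have hbdd : BddAbove {x | e ≤ expScale x} := by
    obtain ⟨M, hM⟩ := (tendsto_expScale_atTop.eventually (gt_mem_nhds he)).exists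
    refine ⟨M, fun _ hy => ?_⟩
    by_contra! h
    exact (hM.trans_le' (antitone_expScale h.le)).not_ge hy
  have hclosed : IsClosed {x | e ≤ expScale x} :=
    isClosed_le continuous_const continuous_expScale
  refine ⟨fun h => ?_, fun h => le_csSup hbdd h⟩
  exact (hclosed.csSup_mem hne hbdd : e ≤ expScale _).trans (antitone_expScale h)

theorem normalOfExp_of_nonpos {e : ℝ} (he : e ≤ 0) : normalOfExp e = 0 := by
  have : {x | e ≤ expScale x} = Set.univ :=
    Set.eq_univ_of_forall fun x => he.trans (expScale_pos x).le
  rw [normalOfExp, this, Real.sSup_univ]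

@[fun_prop]
theorem measurable_normalOfExp : Measurable normalOfExp := by
  refine measurable_of_Ici fun x => ?_
  have : normalOfExp ⁻¹' Set.Ici x =
      (Set.Ioi 0 ∩ Set.Iic (expScale x)) ∪ (Set.Iic 0 ∩ {_e | x ≤ 0}) := by
    ext e
    rcases lt_or_ge 0 e with he | he
    · simp [he, he.not_ge, le_normalOfExp_iff he]
    · simp [he, he.not_gt, normalOfExp_of_nonpos he]
  rw [this]
  measurability

theorem ae_pos_expMeasure : ∀ᵐ e ∂expMeasure 1, 0 < e := by
  have h : (expMeasure 1).real (Set.Iic 0) = 0 := by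
    rw [← cdf_eq_real, cdf_expMeasure_eq one_pos]
    simp
  rw [ae_iff]
  convert (measureReal_eq_zero_iff (measure_ne_top _ _)).1 h using 2
  ext e
  simp

/-- For $E$ exponential, the image is at least $x$ iff $E\le-\log\Phi(x)$, which has probability
$1-\Phi(x)$. -/
theorem map_normalOfExp_expMeasure : (expMeasure 1).map normalOfExp = gaussianReal 0 1 := by
  have : IsProbabilityMeasure ((expMeasure 1).map normalOfExp) :=
    Measure.isProbabilityMeasure_map measurable_normalOfExp.aemeasurable
  refine Measure.ext_of_Ici _ _ fun x => ?_
  rw [Measure.map_apply measurable_normalOfExp measurableSet_Ici]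
  have h1 : expMeasure 1 (normalOfExp ⁻¹' Set.Ici x) = expMeasure 1 (Set.Iic (expScale x)) := by
    refine measure_congr ?_
    filter_upwards [ae_pos_expMeasure] with e he
    exact propext (le_normalOfExp_iff he x)
  have := nullSingletonClass_gaussianReal (μ := 0) (v := 1) one_ne_zero
  rw [h1, ← measure_congr (Ioi_ae_eq_Ici (μ := gaussianReal 0 1) (a := x)),
    ← ENNReal.toReal_eq_toReal_iff' (measure_ne_top _ _) (measure_ne_top _ _),
    ← measureReal_def, ← measureReal_def, ← cdf_eq_real, cdf_expMeasure_eq one_pos,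
    if_pos (expScale_pos x).le, expScale]
  have := stdCDF_add_Ioi x
  rw [one_mul, neg_neg, Real.exp_log (stdCDF_pos x)]
  linarith

theorem tendsto_stdDensity_atTop : Tendsto stdDensity atTop (𝓝 0) := by
  have h : Tendsto (fun x : ℝ => Real.exp (-x ^ 2 / 2)) atTop (𝓝 0) := by
    refine Real.tendsto_exp_atBot.comp ?_
    have : Tendsto (fun x : ℝ => x ^ 2 / 2) atTop atTop :=
      (tendsto_pow_atTop two_ne_zero).atTop_div_const two_pos
    simpa [Function.comp_def, neg_div] using tendsto_neg_atTop_atBot.comp this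
  simpa [stdDensity] using! h.const_mul _

/-- **Mills' ratio**, for `-log Φ` in place of the normal tail. -/
theorem tendsto_expScale_div_atTop :
    Tendsto (fun x => expScale x / (stdDensity x / x)) atTop (𝓝 1) := by
  have hderiv : ∀ x : ℝ, HasDerivAt stdDensity (-x * stdDensity x) x := by
    intro x
    have h : HasDerivAt (fun x : ℝ => -x ^ 2 / 2) (-x) x := by
      have := ((hasDerivAt_pow 2 x).neg).div_const 2
      refine this.congr_deriv ?_
      norm_num
      ring
    refine (h.exp.const_mul (√(2 * Real.pi))⁻¹).congr_deriv ?_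
    simp only [stdDensity]
    ring
  -- The quotient of the derivatives is $1/(\Phi(x)(1+x^{-2}))$.
  refine HasDerivAt.lhopital_zero_atTop (f' := fun x => -(stdDensity x / stdCDF x))
    (g' := fun x => -(stdDensity x * (1 + 1 / x ^ 2)))
    (Eventually.of_forall hasDerivAt_expScale) ?_ ?_ tendsto_expScale_atTop ?_ ?_
  · filter_upwards [eventually_gt_atTop 0] with x hx
    refine ((hderiv x).div (hasDerivAt_id x) hx.ne').congr_deriv ?_
    simp only [id]
    field_simp
    ring
  · filter_upwards [eventually_gt_atTop 0] with x hx
    have := stdDensity_pos x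
    exact neg_ne_zero.2 (by positivity)
  · simpa [div_eq_mul_inv] using! tendsto_stdDensity_atTop.mul tendsto_inv_atTop_zero
  · have h : Tendsto (fun x : ℝ => (stdCDF x * (1 + (x ^ 2)⁻¹))⁻¹) atTop (𝓝 1) := by
      have h2 : Tendsto (fun x : ℝ => (x ^ 2)⁻¹) atTop (𝓝 0) :=
        tendsto_inv_atTop_zero.comp (tendsto_pow_atTop two_ne_zero)
      have := (tendsto_stdCDF_atTop.mul (h2.const_add 1)).inv₀ (by norm_num)
      simpa using this
    refine h.congr' ?_
    filter_upwards [eventually_gt_atTop 0] with x hx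
    have h1 := stdDensity_pos x
    have h2 := stdCDF_pos x
    field_simp

end GaussianTail

/-! ### Asymptotics of the normalizing sequences. -/

section Normalization

theorem tendsto_log_natCast : Tendsto (fun n : ℕ => Real.log n) atTop atTop :=
  Real.tendsto_log_atTop.comp tendsto_natCast_atTop_atTop

theorem tendsto_cSeq : Tendsto cSeq atTop atTop :=
  Real.tendsto_sqrt_atTop.comp (tendsto_log_natCast.const_mul_atTop two_pos)

theorem cSeq_sq (n : ℕ) : cSeq n ^ 2 = 2 * Real.log n :=
  Real.sq_sqrt (by positivity)

/-- The correction `log log n + log (4π)` in the normalizing sequence `d_n`. -/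
noncomputable def dCorr (n : ℕ) : ℝ := Real.log (Real.log n) + Real.log (4 * Real.pi)

theorem dSeq_eq (n : ℕ) : dSeq n = cSeq n - dCorr n / (2 * cSeq n) := rfl

theorem tendsto_dCorr_div : Tendsto (fun n => dCorr n / cSeq n) atTop (𝓝 0) := by
  have h1 : Tendsto (fun x : ℝ => (Real.log x + Real.log (4 * Real.pi)) / √x) atTop (𝓝 0) := by
    have h := (isLittleO_log_rpow_atTop (r := 1 / 2) (by norm_num)).tendsto_div_nhds_zero
    simp_rw [← Real.sqrt_eq_rpow] at h
    have h2 := Real.tendsto_sqrt_atTop.inv_tendsto_atTop.const_mul (Real.log (4 * Real.pi))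
    have := h.add h2
    simp only [mul_zero, add_zero] at this
    refine this.congr fun x => ?_
    simp [div_eq_mul_inv, add_mul]
  have h3 := (h1.comp tendsto_log_natCast).mul_const (√2)⁻¹
  rw [zero_mul] at h3
  refine h3.congr fun n => ?_
  simp only [Function.comp, dCorr, cSeq]
  rw [Real.sqrt_mul zero_le_two]
  simp only [div_eq_mul_inv, mul_inv]
  ring

theorem eventually_cSeq_pos : ∀ᶠ n in atTop, 0 < cSeq n := tendsto_cSeq.eventually_gt_atTop 0

theorem tendsto_shift_div_cSeq (y : ℝ) :
    Tendsto (fun n => (dSeq n + y / cSeq n) / cSeq n) atTop (𝓝 1) := by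
  have hc : Tendsto (fun n => (cSeq n)⁻¹) atTop (𝓝 0) := tendsto_inv_atTop_zero.comp tendsto_cSeq
  have h := ((tendsto_dCorr_div.mul hc).const_mul (-1 / 2)).add ((hc.mul hc).const_mul y)
  have h' := h.const_add 1
  simp only [mul_zero, add_zero] at h'
  refine h'.congr' ?_
  filter_upwards [eventually_cSeq_pos] with n hn
  rw [dSeq_eq]
  field_simp
  ring

theorem tendsto_shift_atTop (y : ℝ) : Tendsto (fun n => dSeq n + y / cSeq n) atTop atTop := by
  have := (tendsto_shift_div_cSeq y).pos_mul_atTop one_pos tendsto_cSeq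
  refine this.congr' ?_
  filter_upwards [eventually_cSeq_pos] with n hn
  field_simp

/-- This explains the form of `dSeq`: completing the square gives $-\log n-y+D/2$ up to a small
square, where $D$ is `dCorr n`, and $e^{D/2}=\sqrt{2\pi}\,c_n$ cancels the remaining prefactor. -/
theorem natCast_mul_stdDensity_div {n : ℕ} (hn : 2 ≤ n) (y : ℝ) :
    n * stdDensity (dSeq n + y / cSeq n) / cSeq n =
      Real.exp (-y - ((y - dCorr n / 2) / cSeq n) ^ 2 / 2) := by
  have hn0 : (0 : ℝ) < n := by positivity
  have hlog : 0 < Real.log n := Real.log_pos (by exact_mod_cast hn)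
  have hc : 0 < cSeq n := Real.sqrt_pos.2 (by positivity)
  have hpi := Real.pi_pos
  have hquad : -(dSeq n + y / cSeq n) ^ 2 / 2 =
      -(Real.log n) - (y - dCorr n / 2) - ((y - dCorr n / 2) / cSeq n) ^ 2 / 2 := by
    have : dSeq n + y / cSeq n = cSeq n + (y - dCorr n / 2) / cSeq n := by
      rw [dSeq_eq]; field_simp; ring
    rw [this, add_sq, cSeq_sq]
    field_simp
    ring
  have hconst : Real.exp (dCorr n / 2) = √(2 * Real.pi) * cSeq n := by
    rw [dCorr, ← Real.log_mul hlog.ne' (by positivity), Real.exp_half,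
      Real.exp_log (by positivity), cSeq, ← Real.sqrt_mul (by positivity)]
    congr 1
    ring
  have hs : 0 < √(2 * Real.pi) := Real.sqrt_pos.2 (by positivity)
  rw [stdDensity, hquad, show -(Real.log n) - (y - dCorr n / 2) -
      ((y - dCorr n / 2) / cSeq n) ^ 2 / 2 = -(Real.log n) + dCorr n / 2 +
      (-y - ((y - dCorr n / 2) / cSeq n) ^ 2 / 2) by ring, Real.exp_add, Real.exp_add, hconst,
    Real.exp_neg, Real.exp_log hn0]
  field_simp

theorem tendsto_natCast_mul_stdDensity_div (y : ℝ) :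
    Tendsto (fun n : ℕ => n * (stdDensity (dSeq n + y / cSeq n) / (dSeq n + y / cSeq n))) atTop
      (𝓝 (Real.exp (-y))) := by
  have hc : Tendsto (fun n => (cSeq n)⁻¹) atTop (𝓝 0) := tendsto_inv_atTop_zero.comp tendsto_cSeq
  have h0 : Tendsto (fun n => (y - dCorr n / 2) / cSeq n) atTop (𝓝 0) := by
    have := (hc.const_mul y).sub (tendsto_dCorr_div.const_mul (1 / 2))
    simp only [mul_zero, sub_zero] at this
    refine this.congr fun n => ?_
    ring
  have h1 : Tendsto (fun n => Real.exp (-y - ((y - dCorr n / 2) / cSeq n) ^ 2 / 2)) atTop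
      (𝓝 (Real.exp (-y))) := by
    have := (((h0.pow 2).div_const 2).const_sub (-y)).rexp
    simpa using this
  have h2 := h1.mul ((tendsto_shift_div_cSeq y).inv₀ one_ne_zero)
  rw [inv_one, mul_one] at h2
  refine h2.congr' ?_
  filter_upwards [eventually_ge_atTop 2, eventually_cSeq_pos,
    (tendsto_shift_atTop y).eventually_gt_atTop 0] with n hn hcn hx
  rw [← natCast_mul_stdDensity_div hn]
  field_simp

/-- The normal domain of attraction. -/
theorem tendsto_natCast_mul_expScale (y : ℝ) :
    Tendsto (fun n : ℕ => n * expScale (dSeq n + y / cSeq n)) atTop (𝓝 (Real.exp (-y))) := by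
  have h := (tendsto_natCast_mul_stdDensity_div y).mul
    (tendsto_expScale_div_atTop.comp (tendsto_shift_atTop y))
  rw [mul_one] at h
  refine h.congr' ?_
  filter_upwards [(tendsto_shift_atTop y).eventually_gt_atTop 0] with n hx
  have := stdDensity_pos (dSeq n + y / cSeq n)
  simp only [Function.comp]
  field_simp

theorem tendsto_dSeq_div_cSeq : Tendsto (fun n => dSeq n / cSeq n) atTop (𝓝 1) := by
  simpa using tendsto_shift_div_cSeq 0

theorem tendsto_dSeq : Tendsto dSeq atTop atTop := by
  simpa using tendsto_shift_atTop 0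

/-- Uniform upper bound for the normal tail to the right of `d_n / 2`. -/
theorem eventually_natCast_mul_expScale_le :
    ∀ᶠ n : ℕ in atTop, ∀ x, dSeq n / 2 ≤ x →
      n * expScale x ≤ 8 * Real.exp (-((x - dSeq n) * dSeq n)) := by
  obtain ⟨A, hA⟩ := (((tendsto_expScale_div_atTop.eventually_le_const one_lt_two)).and
    (eventually_gt_atTop 0)).exists_forall_of_atTop
  have h0 : ∀ᶠ n : ℕ in atTop, n * (stdDensity (dSeq n) / dSeq n) ≤ 2 := by
    have := (tendsto_natCast_mul_stdDensity_div 0).eventually_le_const (u := 2) (by norm_num)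
    simpa using this
  filter_upwards [h0, tendsto_dSeq.eventually_ge_atTop (2 * A), tendsto_dSeq.eventually_gt_atTop 0]
    with n hn hdA hd x hx
  obtain ⟨hx2, hx0⟩ := hA x (by linarith)
  have hφ := stdDensity_pos x
  rw [div_le_iff₀ (by positivity)] at hx2
  have hdens : stdDensity x ≤ stdDensity (dSeq n) * Real.exp (-((x - dSeq n) * dSeq n)) := by
    rw [stdDensity, stdDensity, mul_assoc, ← Real.exp_add]
    refine mul_le_mul_of_nonneg_left (Real.exp_le_exp.2 ?_) (by positivity)
    nlinarith [sq_nonneg (x - dSeq n)]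
  have hdiv : stdDensity x / x ≤
      stdDensity (dSeq n) * Real.exp (-((x - dSeq n) * dSeq n)) / (dSeq n / 2) :=
    div_le_div₀ (by have := stdDensity_pos (dSeq n); positivity) hdens (by positivity) hx
  -- The 8 collects three factors 2: Mills' ratio, $1/x\le2/d_n$, and $n\varphi(d_n)/d_n\le2$.
  calc n * expScale x ≤ n * (2 * (stdDensity x / x)) := by gcongr
    _ ≤ n * (2 * (stdDensity (dSeq n) * Real.exp (-((x - dSeq n) * dSeq n)) / (dSeq n / 2))) := by
      gcongr
    _ = 4 * (n * (stdDensity (dSeq n) / dSeq n)) * Real.exp (-((x - dSeq n) * dSeq n)) := by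
      field_simp
      ring
    _ ≤ 4 * 2 * Real.exp (-((x - dSeq n) * dSeq n)) := by gcongr
    _ = _ := by ring

end Normalization

/-! ### Convergence of the coupled maxima along a fixed path. -/

section Pathwise

/-- Suprema over growing finite index sets converge along with their terms, provided that the
terms are dominated by a function tending to `-∞`. -/
theorem tendsto_iSup_of_le_of_tendsto_atBot {ι : Type*} [Nonempty ι] {J : ℕ → Type*}
    [∀ n, Finite (J n)] (e : ∀ n, J n → ι) (he : ∀ p, ∀ᶠ n in atTop, p ∈ Set.range (e n))
    {a : ℕ → ι → ℝ} {b g : ι → ℝ} (hab : ∀ p, Tendsto (fun n => a n p) atTop (𝓝 (b p)))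
    (hg : Tendsto g cofinite atBot) (hag : ∀ᶠ n in atTop, ∀ j, a n (e n j) ≤ g (e n j)) :
    BddAbove (Set.range b) ∧
      Tendsto (fun n => ⨆ j, a n (e n j)) atTop (𝓝 (⨆ p, b p)) := by
  have hbg : ∀ p, b p ≤ g p := fun p => by
    refine le_of_tendsto (hab p) ?_
    filter_upwards [he p, hag] with n ⟨j, hj⟩ hn
    exact hj ▸ hn j
  have hbdd : BddAbove (Set.range b) := by
    have hfin : {p | ¬ g p ≤ 0}.Finite := hg.eventually_le_atBot 0
    obtain ⟨M, hM⟩ := (hfin.image g).bddAbove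
    refine ⟨max M 0, ?_⟩
    rintro _ ⟨p, rfl⟩
    by_cases hp : g p ≤ 0
    · exact le_max_of_le_right ((hbg p).trans hp)
    · exact le_max_of_le_left ((hbg p).trans (hM ⟨p, hp, rfl⟩))
  have hbddn : ∀ n, BddAbove (Set.range fun j => a n (e n j)) := fun n =>
    (Set.finite_range _).bddAbove
  refine ⟨hbdd, tendsto_order.2 ⟨fun x hx => ?_, fun x hx => ?_⟩⟩
  · obtain ⟨p, hp⟩ := exists_lt_of_lt_ciSup hx
    filter_upwards [he p, (hab p).eventually_const_lt hp] with n ⟨j, hj⟩ hn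
    refine lt_of_lt_of_le ?_ (le_ciSup (hbddn n) j)
    rwa [hj]
  · obtain ⟨y, hy, hyx⟩ := exists_between hx
    -- Outside this finite set the domination suffices; on it, pointwise convergence holds
    -- uniformly.
    have hfin : {p | ¬ g p ≤ y}.Finite := hg.eventually_le_atBot y
    have hev : ∀ᶠ n in atTop, ∀ p ∈ {p | ¬ g p ≤ y}, a n p ≤ y :=
      (eventually_all_finite hfin).2 fun p _ =>
        (hab p).eventually_le_const ((le_ciSup hbdd p).trans_lt hy)
    -- An index in the range ensures that `J n` is nonempty; an empty real supremum would be 0.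
    filter_upwards [hev, hag, he (Classical.arbitrary ι)] with n hn hn' ⟨j₀, _⟩
    have : Nonempty (J n) := ⟨j₀⟩
    refine lt_of_le_of_lt (ciSup_le fun j => ?_) hyx
    by_cases hj : g (e n j) ≤ y
    · exact (hn' j).trans hj
    · exact hn _ hj

/-- The inclusion of the pairs in `Fin n` into the pairs of natural numbers. -/
def Pair.toNat {n : ℕ} (p : Pair n) : NatPair := ⟨(p.1.1, p.1.2), p.2⟩

theorem eventually_mem_range_toNat (p : NatPair) :
    ∀ᶠ n in atTop, p ∈ Set.range (Pair.toNat (n := n)) := by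
  filter_upwards [eventually_gt_atTop p.1.2] with n hn
  exact ⟨⟨(⟨p.1.1, p.2.trans hn⟩, ⟨p.1.2, hn⟩), p.2⟩, rfl⟩

/-- The logarithmic size `log (i + 1) + log (j + 1)` of a pair. -/
noncomputable def logSize (p : NatPair) : ℝ := Real.log (p.1.1 + 1) + Real.log (p.1.2 + 1)

theorem logSize_nonneg (p : NatPair) : 0 ≤ logSize p :=
  add_nonneg (Real.log_nonneg (by simp)) (Real.log_nonneg (by simp))

theorem tendsto_logSize : Tendsto logSize cofinite atTop := by
  refine tendsto_atTop.2 fun M => ?_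
  obtain ⟨m, hm⟩ := exists_nat_ge (Real.exp M)
  have hfin : {p : NatPair | p.1.2 ≤ m}.Finite := by
    refine Set.Finite.of_finite_image (f := Subtype.val)
      (((Set.finite_Iic m).prod (Set.finite_Iic m)).subset ?_) Subtype.val_injective.injOn
    rintro _ ⟨p, hp, rfl⟩
    exact ⟨p.2.le.trans hp, hp⟩
  refine hfin.subset fun p hp => ?_
  by_contra! h
  refine hp (le_add_of_nonneg_of_le (Real.log_nonneg (by simp)) ?_)
  rw [Real.le_log_iff_exp_le (by positivity)]
  have : (m : ℝ) < p.1.2 := by exact_mod_cast (not_le.1 h)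
  linarith

/-- The order statistics of the Rényi representation, for a sequence of spacings. -/
noncomputable def renyiSeq (ζ : ℕ → ℝ) (n i : ℕ) : ℝ :=
  ∑ j ∈ Finset.range (i + 1), ζ j / ((n : ℝ) - j)

theorem renyi_eq_renyiSeq (ζ : ℕ → ℝ) {n : ℕ} (i : Fin n) :
    renyi n (fun j => ζ j) i = renyiSeq ζ n i := by
  simp only [renyi, Fin.le_def]
  rw [Fin.sum_univ_eq_sum_range (fun j => if j ≤ (i : ℕ) then ζ j / ((n : ℝ) - j) else 0) n,
    ← Finset.sum_filter, renyiSeq]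
  congr 1
  ext j
  simp
  omega

variable {ζ : ℕ → ℝ}

theorem sum_div_le_renyiSeq (hζ : ∀ k, 0 < ζ k) {n i : ℕ} (hi : i < n) :
    (∑ k ∈ Finset.range (i + 1), ζ k) / n ≤ renyiSeq ζ n i := by
  rw [Finset.sum_div]
  refine Finset.sum_le_sum fun j hj => div_le_div_of_nonneg_left (hζ j).le ?_ ?_
  · exact natCast_sub_fin_pos (⟨j, by simp at hj; omega⟩ : Fin n)
  · simp

theorem renyiSeq_pos (hζ : ∀ k, 0 < ζ k) {n i : ℕ} (hi : i < n) : 0 < renyiSeq ζ n i :=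
  Finset.sum_pos (fun j hj => div_pos (hζ j)
    (natCast_sub_fin_pos (⟨j, by simp at hj; omega⟩ : Fin n))) (by simp)

theorem tendsto_natCast_mul_renyiSeq (ζ : ℕ → ℝ) (i : ℕ) :
    Tendsto (fun n : ℕ => n * renyiSeq ζ n i) atTop
      (𝓝 (∑ k ∈ Finset.range (i + 1), ζ k)) := by
  simp only [renyiSeq, Finset.mul_sum]
  refine tendsto_finsetSum _ fun j _ => ?_
  have h : Tendsto (fun n : ℕ => (n : ℝ) / ((n : ℝ) + -j)) atTop (𝓝 1) :=
    tendsto_natCast_div_add_atTop _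
  have := h.const_mul (ζ j)
  rw [mul_one] at this
  refine this.congr fun n => ?_
  rw [← sub_eq_add_neg]
  ring

/-- The rescaled `i`-th largest of `n` normal variables. -/
noncomputable def scaledOrder (ζ : ℕ → ℝ) (n i : ℕ) : ℝ :=
  cSeq n * (normalOfExp (renyiSeq ζ n i) - dSeq n)

/-- Bounds on normal order statistics become comparisons of two quantities with explicit limits,
$e^{-\eta_i}$ and $e^{-y}$. -/
theorem le_scaledOrder_iff (hζ : ∀ k, 0 < ζ k) {n i : ℕ} (hi : i < n) (hc : 0 < cSeq n) (y : ℝ) :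
    y ≤ scaledOrder ζ n i ↔ n * renyiSeq ζ n i ≤ n * expScale (dSeq n + y / cSeq n) := by
  have hn : (0 : ℝ) < n := by exact_mod_cast (Nat.zero_le i).trans_lt hi
  rw [mul_le_mul_iff_right₀ hn, ← le_normalOfExp_iff (renyiSeq_pos hζ hi), scaledOrder,
    ← div_le_iff₀' hc, le_sub_iff_add_le']

theorem tendsto_scaledOrder (hζ : ∀ k, 0 < ζ k) (i : ℕ) :
    Tendsto (fun n => scaledOrder ζ n i) atTop
      (𝓝 (-Real.log (∑ k ∈ Finset.range (i + 1), ζ k))) := by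
  set s := ∑ k ∈ Finset.range (i + 1), ζ k with hs
  have hspos : 0 < s := Finset.sum_pos (fun k _ => hζ k) (by simp)
  have hξ := tendsto_natCast_mul_renyiSeq ζ i
  refine tendsto_order.2 ⟨fun x hx => ?_, fun x hx => ?_⟩
  · obtain ⟨y, hxy, hy⟩ := exists_between hx
    have hlt : s < Real.exp (-y) := by rw [← Real.log_lt_iff_lt_exp hspos]; linarith
    filter_upwards [hξ.eventually_lt (tendsto_natCast_mul_expScale y) hlt,
      eventually_gt_atTop i, eventually_cSeq_pos] with n hn hin hc
    exact hxy.trans_le ((le_scaledOrder_iff hζ hin hc y).2 hn.le)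
  · have hlt : Real.exp (-x) < s := by rw [← Real.lt_log_iff_exp_lt hspos]; linarith
    filter_upwards [(tendsto_natCast_mul_expScale x).eventually_lt hξ hlt,
      eventually_gt_atTop i, eventually_cSeq_pos] with n hn hin hc
    exact lt_of_not_ge fun h => ((le_scaledOrder_iff hζ hin hc x).1 h).not_gt hn

theorem eventually_scaledOrder_le (hζ : ∀ k, 0 < ζ k) {κ : ℝ} (hκ : 0 < κ)
    (hsum : ∀ i : ℕ, κ * (i + 1) ≤ ∑ k ∈ Finset.range (i + 1), ζ k) :
    ∃ C, 0 ≤ C ∧ ∀ᶠ n in atTop, ∀ i < n,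
      scaledOrder ζ n i ≤ C - 1 / 2 * Real.log (i + 1) := by
  refine ⟨2 * |Real.log 8 - Real.log κ|, by positivity, ?_⟩
  set C := |Real.log 8 - Real.log κ|
  have hC0 : 0 ≤ C := abs_nonneg _
  have h1 := tendsto_dSeq_div_cSeq.eventually_const_le (u := 1 / 2) (by norm_num)
  have h2 := tendsto_dSeq_div_cSeq.eventually_le_const (u := 2) (by norm_num)
  filter_upwards [h1, h2, eventually_cSeq_pos, eventually_natCast_mul_expScale_le]
    with n h1 h2 hc hn i hi
  rw [le_div_iff₀ hc] at h1
  rw [div_le_iff₀ hc] at h2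
  have hn0 : (0 : ℝ) < n := by exact_mod_cast (Nat.zero_le i).trans_lt hi
  have hl0 : 0 ≤ Real.log (i + 1) := Real.log_nonneg (by simp)
  rw [scaledOrder]
  set x := normalOfExp (renyiSeq ζ n i) with hx
  rcases lt_or_ge x (dSeq n / 2) with hxd | hxd
  -- Far below $d_n$, $c_n(x-d_n)\le-c_nd_n/2\le-c_n^2/4=-\frac12\log n$.
  · have hl : Real.log (i + 1) ≤ Real.log n :=
      Real.log_le_log (by positivity) (by exact_mod_cast hi)
    have := cSeq_sq n
    nlinarith
  · have hξ : renyiSeq ζ n i ≤ expScale x := (le_normalOfExp_iff (renyiSeq_pos hζ hi) x).1 le_rfl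
    have h3 : κ * (i + 1) ≤ 8 * Real.exp (-((x - dSeq n) * dSeq n)) := by
      refine (hsum i).trans (le_trans ?_ (hn x hxd))
      have := sum_div_le_renyiSeq hζ hi
      rw [div_le_iff₀' hn0] at this
      exact this.trans (mul_le_mul_of_nonneg_left hξ hn0.le)
    have h4 := Real.log_le_log (by positivity) h3
    rw [Real.log_mul hκ.ne' (by positivity), Real.log_mul (by norm_num) (Real.exp_pos _).ne',
      Real.log_exp] at h4
    have h5 : (x - dSeq n) * dSeq n ≤ C - Real.log (i + 1) := by
      linarith [le_abs_self (Real.log 8 - Real.log κ)]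
    -- Replacing $d_n$ by $c_n$ uses $c_n\le2d_n$ for a positive deviation and $c_n\ge d_n/2$ for a
    -- negative one; this yields the factors 2 and 1/2.
    rcases le_total 0 (x - dSeq n) with h | h
    · nlinarith
    · nlinarith

section Parameters

variable {r : ℕ → ℝ} {lam : ℝ}

theorem tendsto_one_sub_two_mul
    (hlim : Tendsto (fun n : ℕ => (1 - 2 * r n) * Real.log n) atTop (𝓝 lam)) :
    Tendsto (fun n => 1 - 2 * r n) atTop (𝓝 0) := by
  have h := hlim.mul (tendsto_inv_atTop_zero.comp tendsto_log_natCast)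
  rw [mul_zero] at h
  refine h.congr' ?_
  filter_upwards [tendsto_log_natCast.eventually_gt_atTop 0] with n hn
  simp only [Function.comp]
  field_simp

theorem tendsto_sqrt_param
    (hlim : Tendsto (fun n : ℕ => (1 - 2 * r n) * Real.log n) atTop (𝓝 lam)) :
    Tendsto (fun n => √(r n)) atTop (𝓝 (√2)⁻¹) := by
  have h := (((tendsto_one_sub_two_mul hlim).const_sub 1).div_const 2).sqrt
  rw [sub_zero, Real.sqrt_div zero_le_one, Real.sqrt_one, one_div] at h
  refine h.congr fun n => ?_
  congr 1
  ring

theorem tendsto_cSeq_mul_sqrt (hr : ∀ n, r n ≤ 1 / 2)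
    (hlim : Tendsto (fun n : ℕ => (1 - 2 * r n) * Real.log n) atTop (𝓝 lam)) :
    Tendsto (fun n => cSeq n * √(1 - 2 * r n)) atTop (𝓝 √(2 * lam)) := by
  refine (hlim.const_mul 2).sqrt.congr fun n => ?_
  rw [cSeq, ← Real.sqrt_mul' _ (by linarith [hr n])]
  congr 1
  ring

/-- Rationalizing, $2\sqrt r-\sqrt2=-2(1-2r)/(2\sqrt r+\sqrt2)$, while $c_nd_n\sim2\log n$; the
limit is $-4\lambda/(2\sqrt2)$. -/
theorem tendsto_centering (hr : ∀ n, r n ∈ Set.Icc (0 : ℝ) (1 / 2))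
    (hlim : Tendsto (fun n : ℕ => (1 - 2 * r n) * Real.log n) atTop (𝓝 lam)) :
    Tendsto (fun n => (2 * √(r n) - √2) * (cSeq n * dSeq n)) atTop (𝓝 (-(√2 * lam))) := by
  have h2 : (0 : ℝ) < √2 := by positivity
  have hs : √2 ^ 2 = (2 : ℝ) := Real.sq_sqrt zero_le_two
  have hden : Tendsto (fun n => 2 * √(r n) + √2) atTop (𝓝 (2 * (√2)⁻¹ + √2)) :=
    ((tendsto_sqrt_param hlim).const_mul 2).add_const _
  have h := ((hlim.mul tendsto_dSeq_div_cSeq).const_mul (-4)).div hden (by positivity)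
  have heq : -4 * (lam * 1) / (2 * (√2)⁻¹ + √2) = -(√2 * lam) := by
    field_simp
    rw [hs]
    ring
  rw [heq] at h
  refine h.congr' ?_
  filter_upwards [eventually_cSeq_pos] with n hc
  have hrn : √(r n) ^ 2 = r n := Real.sq_sqrt (hr n).1
  have hpos : 0 < 2 * √(r n) + √2 := by positivity
  have hL : Real.log n = cSeq n ^ 2 / 2 := by rw [cSeq_sq]; ring
  simp only [Pi.div_apply]
  rw [div_eq_iff hpos.ne', hL]
  field_simp
  linear_combination (2 * dSeq n) * (hs - 4 * hrn)

end Parameters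

/-- The field built from the order statistics of the Rényi representation. -/
noncomputable def coupledField (r : ℝ) (ζ : ℕ → ℝ) (z : NatPair → ℝ) (n : ℕ) (p : NatPair) : ℝ :=
  √r * (normalOfExp (renyiSeq ζ n p.1.1) + normalOfExp (renyiSeq ζ n p.1.2)) +
    √(1 - 2 * r) * z p

theorem tendsto_iSup_coupledField {r : ℕ → ℝ} {lam : ℝ}
    (hr : ∀ n, r n ∈ Set.Icc (0 : ℝ) (1 / 2))
    (hlim : Tendsto (fun n : ℕ => (1 - 2 * r n) * Real.log n) atTop (𝓝 lam))
    (hζ : ∀ k, 0 < ζ k) {κ : ℝ} (hκ : 0 < κ)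
    (hsum : ∀ i : ℕ, κ * (i + 1) ≤ ∑ k ∈ Finset.range (i + 1), ζ k)
    {z : NatPair → ℝ} (hz : ∀ δ > 0, ∃ C, ∀ p, z p ≤ C + δ * logSize p) {b : NatPair → ℝ}
    (hb : ∀ p : NatPair, b p = (-Real.log (∑ k ∈ Finset.range (p.1.1 + 1), ζ k) +
      -Real.log (∑ k ∈ Finset.range (p.1.2 + 1), ζ k)) / √2 + √(2 * lam) * z p) :
    BddAbove (Set.range b) ∧
    Tendsto (fun n => cSeq n * ((⨆ p : Pair n, coupledField (r n) ζ z n p.toNat) - √2 * dSeq n))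
      atTop (𝓝 ((⨆ p, b p) - √2 * lam)) := by
  have : Nonempty NatPair := ⟨⟨(0, 1), one_pos⟩⟩
  set a : ℕ → NatPair → ℝ := fun n p =>
    √(r n) * (scaledOrder ζ n p.1.1 + scaledOrder ζ n p.1.2) +
      cSeq n * √(1 - 2 * r n) * z p with ha
  have hab : ∀ p, Tendsto (fun n => a n p) atTop (𝓝 (b p)) := fun p => by
    rw [hb, div_eq_inv_mul]
    exact ((tendsto_sqrt_param hlim).mul
      ((tendsto_scaledOrder hζ p.1.1).add (tendsto_scaledOrder hζ p.1.2))).add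
      ((tendsto_cSeq_mul_sqrt (fun n => (hr n).2) hlim).mul_const _)
  obtain ⟨C, hC0, hC⟩ := eventually_scaledOrder_le hζ hκ hsum
  set B := √(2 * lam) + 1 with hB
  have hBpos : 0 < B := by positivity
  -- `B` eventually bounds the noise coefficient, so the noise costs at most 1/8 of `logSize`. The
  -- order statistics gain 1/4, since eventually $\sqrt r\ge1/2$; a net decay of 1/8 remains.
  obtain ⟨D, hD⟩ := hz (1 / (8 * B)) (by positivity)
  have hg : Tendsto (fun p => (2 * C + B * |D|) + -(1 / 8 * logSize p)) cofinite atBot :=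
    tendsto_atBot_add_const_left _ _
      (tendsto_neg_atTop_atBot.comp (tendsto_logSize.const_mul_atTop (by norm_num)))
  have hhalf : (1 : ℝ) / 2 < (√2)⁻¹ := by
    rw [one_div, inv_lt_inv₀ two_pos (by positivity), Real.sqrt_lt' two_pos]
    norm_num
  have hag : ∀ᶠ n in atTop, ∀ p : Pair n,
      a n p.toNat ≤ (2 * C + B * |D|) + -(1 / 8 * logSize p.toNat) := by
    filter_upwards [hC, (tendsto_sqrt_param hlim).eventually_const_le hhalf,
      (tendsto_cSeq_mul_sqrt (fun n => (hr n).2) hlim).eventually_le_const (lt_add_one _)]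
      with n hn hrl hcl p
    have h1 := hn p.1.1 p.1.1.2
    have h2 := hn p.1.2 p.1.2.2
    have hl := logSize_nonneg p.toNat
    have hsr : √(r n) ≤ 1 := Real.sqrt_le_one.2 (by linarith [(hr n).2])
    have hY : √(r n) * (scaledOrder ζ n p.1.1 + scaledOrder ζ n p.1.2) ≤
        2 * C - 1 / 4 * logSize p.toNat := by
      have hle : scaledOrder ζ n p.1.1 + scaledOrder ζ n p.1.2 ≤
          2 * C - 1 / 2 * logSize p.toNat := by
        simp only [logSize, Pair.toNat] at *
        linarith
      calc _ ≤ √(r n) * (2 * C - 1 / 2 * logSize p.toNat) := by gcongr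
        _ ≤ _ := by nlinarith
    have hZ : cSeq n * √(1 - 2 * r n) * z p.toNat ≤ B * |D| + 1 / 8 * logSize p.toNat := by
      have hc0 : 0 ≤ cSeq n * √(1 - 2 * r n) := mul_nonneg (Real.sqrt_nonneg _) (Real.sqrt_nonneg _)
      calc _ ≤ cSeq n * √(1 - 2 * r n) * (|D| + 1 / (8 * B) * logSize p.toNat) := by
            gcongr
            exact (hD _).trans (by gcongr; exact le_abs_self D)
        _ ≤ B * (|D| + 1 / (8 * B) * logSize p.toNat) := by gcongr
        _ = _ := by field_simp
    simp only [ha]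
    have e1 : (Pair.toNat p).1.1 = p.1.1 := rfl
    have e2 : (Pair.toNat p).1.2 = p.1.2 := rfl
    rw [e1, e2]
    linarith
  obtain ⟨hbdd, ht⟩ := tendsto_iSup_of_le_of_tendsto_atBot (fun n => Pair.toNat (n := n))
    eventually_mem_range_toNat hab hg hag
  refine ⟨hbdd, ?_⟩
  rw [sub_eq_add_neg]
  refine (ht.add (tendsto_centering hr hlim)).congr' ?_
  filter_upwards [eventually_ge_atTop 2] with n hn
  have : Nonempty (Pair n) := ⟨⟨(⟨0, by omega⟩, ⟨1, by omega⟩), by simp [Fin.lt_def]⟩⟩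
  have hsup : cSeq n * (⨆ p : Pair n, coupledField (r n) ζ z n p.toNat) =
      (⨆ p : Pair n, a n p.toNat) + 2 * √(r n) * (cSeq n * dSeq n) := by
    rw [Real.mul_iSup_of_nonneg (show 0 ≤ cSeq n from Real.sqrt_nonneg _),
      ciSup_add (Set.finite_range _).bddAbove]
    refine iSup_congr fun p => ?_
    simp only [ha, coupledField, scaledOrder]
    ring
  rw [mul_sub, hsup]
  ring

end Pathwise

/-! ### The law of the maximum and its invariance under permutations. -/

section FieldLaw

theorem charFunDual_map_of_hasGaussianLaw {ι Ω : Type*} [Fintype ι] [DecidableEq ι]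
    [MeasurableSpace Ω] {P : Measure Ω} [IsProbabilityMeasure P] {X : ι → Ω → ℝ}
    (hX : HasGaussianLaw (fun ω p => X p ω) P)
    (h0 : ∀ p, ∫ ω, X p ω ∂P = 0) (L : StrongDual ℝ (ι → ℝ)) :
    charFunDual (P.map fun ω p => X p ω) L =
      Complex.exp (-((∑ p, ∑ q, L (Pi.single p 1) * (L (Pi.single q 1) *
        ∫ ω, X p ω * X q ω ∂P) : ℝ) : ℂ) / 2) := by
  have := hX.isGaussian_map
  have hXp : ∀ p, HasGaussianLaw (X p) P := fun p => hX.eval p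
  have h2 : ∀ p, MemLp (X p) 2 P := fun p => (hXp p).memLp_two
  have hL : ∀ ω, L (fun p => X p ω) = ∑ p, L (Pi.single p 1) * X p ω := by
    intro ω
    conv_lhs => rw [pi_eq_sum_univ' (fun p => X p ω), map_sum]
    refine Finset.sum_congr rfl fun p _ => ?_
    rw [map_smul, smul_eq_mul, mul_comm]
  have hmean : ∫ ω, L (fun p => X p ω) ∂P = 0 := by
    simp_rw [hL]
    rw [integral_finsetSum _ fun p _ => ((h2 p).integrable one_le_two).const_mul _]
    simp [integral_const_mul, h0]
  have hvar : Var[fun ω => L (fun p => X p ω); P] =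
      ∑ p, ∑ q, L (Pi.single p 1) * (L (Pi.single q 1) * ∫ ω, X p ω * X q ω ∂P) := by
    simp_rw [hL]
    rw [variance_fun_sum fun p => (h2 p).const_mul _]
    refine Finset.sum_congr rfl fun p _ => Finset.sum_congr rfl fun q _ => ?_
    rw [covariance_const_mul_left, covariance_const_mul_right, covariance_eq_sub (h2 p) (h2 q),
      h0, h0, mul_zero, sub_zero]
    rfl
  rw [IsGaussian.charFunDual_eq, integral_complex_ofReal,
    integral_map hX.aemeasurable (by fun_prop), variance_map (by fun_prop) hX.aemeasurable, hmean]
  simp only [Function.comp_def]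
  rw [hvar]
  congr 1
  push_cast
  ring

/-- Centered Gaussian vectors with the same second moments have the same law. -/
theorem map_eq_of_hasGaussianLaw {ι Ω Ω' : Type*} [Fintype ι] [DecidableEq ι]
    [MeasurableSpace Ω] [MeasurableSpace Ω'] {P : Measure Ω} [IsProbabilityMeasure P]
    {Q : Measure Ω'} [IsProbabilityMeasure Q] {X : ι → Ω → ℝ} {Y : ι → Ω' → ℝ}
    (hX : HasGaussianLaw (fun ω p => X p ω) P) (hY : HasGaussianLaw (fun ω p => Y p ω) Q)
    (hX0 : ∀ p, ∫ ω, X p ω ∂P = 0) (hY0 : ∀ p, ∫ ω, Y p ω ∂Q = 0)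
    (hXY : ∀ p q, ∫ ω, X p ω * X q ω ∂P = ∫ ω, Y p ω * Y q ω ∂Q) :
    P.map (fun ω p => X p ω) = Q.map (fun ω p => Y p ω) := by
  have := hX.isGaussian_map
  have := hY.isGaussian_map
  refine Measure.ext_of_charFunDual ?_
  ext L
  rw [charFunDual_map_of_hasGaussianLaw hX hX0, charFunDual_map_of_hasGaussianLaw hY hY0]
  simp_rw [hXY]

/-- The law of independent standard normal variables. -/
noncomputable abbrev stdPi (ι : Type*) [Fintype ι] : Measure (ι → ℝ) :=
  Measure.pi fun _ => gaussianReal 0 1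

theorem integral_eval_stdPi {ι : Type*} [Fintype ι] (k : ι) : ∫ w, w k ∂stdPi ι = 0 := by
  have h := (measurePreserving_eval (fun _ : ι => gaussianReal 0 1) k).hasLaw
  simpa using! h.integral_eq

theorem memLp_eval_stdPi {ι : Type*} [Fintype ι] (k : ι) :
    MemLp (fun w : ι → ℝ => w k) 2 (stdPi ι) :=
  (memLp_id_gaussianReal 2).comp_measurePreserving
    (measurePreserving_eval (fun _ : ι => gaussianReal 0 1) k)

theorem integral_eval_mul_eval_stdPi {ι : Type*} [Fintype ι] [DecidableEq ι] (k l : ι) :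
    ∫ w, w k * w l ∂stdPi ι = if k = l then 1 else 0 := by
  have hcov := covariance_eq_sub (memLp_eval_stdPi k) (memLp_eval_stdPi l)
  rw [integral_eval_stdPi, zero_mul, sub_zero] at hcov
  refine hcov.symm.trans ?_
  split_ifs with h
  · subst h
    rw [covariance_self (measurable_pi_apply k).aemeasurable]
    have h := (measurePreserving_eval (fun _ : ι => gaussianReal 0 1) k).hasLaw
    simpa using! h.variance_eq
  · have hind : iIndepFun (fun (k : ι) (w : ι → ℝ) => w k) (stdPi ι) :=
      iIndepFun_pi (X := fun _ x => x) fun _ => aemeasurable_id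
    exact (hind.indepFun h).covariance_eq_zero (memLp_eval_stdPi k) (memLp_eval_stdPi l)

/-- The linear combination `∑ k, a p k * w k` of independent standard normal variables. -/
noncomputable def linearField {ι κ : Type*} [Fintype κ] (a : ι → κ → ℝ) (p : ι) (w : κ → ℝ) : ℝ :=
  ∑ k, a p k * w k

theorem hasGaussianLaw_linearField {ι κ : Type*} [Fintype ι] [Fintype κ] (a : ι → κ → ℝ) :
    HasGaussianLaw (fun w p => linearField a p w) (stdPi κ) := by
  have h : HasGaussianLaw (fun w : κ → ℝ => w) (stdPi κ) := by
    have hind : iIndepFun (fun (k : κ) (w : κ → ℝ) => w k) (stdPi κ) :=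
      iIndepFun_pi (X := fun _ x => x) fun _ => aemeasurable_id
    exact hind.hasGaussianLaw fun k =>
      ((measurePreserving_eval (fun _ : κ => gaussianReal 0 1) k).hasLaw).hasGaussianLaw
  exact h.map (ContinuousLinearMap.pi fun p => ∑ k, a p k • ContinuousLinearMap.proj k) |>.congr
    (Eventually.of_forall fun w => by ext p; simp [linearField])

theorem integral_linearField {ι κ : Type*} [Fintype κ] (a : ι → κ → ℝ) (p : ι) :
    ∫ w, linearField a p w ∂stdPi κ = 0 := by
  simp only [linearField]
  rw [integral_finsetSum _ fun k _ => ((memLp_eval_stdPi k).integrable one_le_two).const_mul _]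
  simp [integral_const_mul, integral_eval_stdPi]

theorem integral_linearField_mul {ι κ : Type*} [Fintype κ] (a : ι → κ → ℝ) (p q : ι) :
    ∫ w, linearField a p w * linearField a q w ∂stdPi κ = ∑ k, a p k * a q k := by
  classical
  have hint : ∀ k l, Integrable (fun w : κ → ℝ => a p k * w k * (a q l * w l)) (stdPi κ) := by
    intro k l
    have := ((memLp_eval_stdPi k).integrable_mul (memLp_eval_stdPi l)).const_mul (a p k * a q l)
    refine this.congr (Eventually.of_forall fun w => ?_)
    simp only [Pi.mul_apply]
    ring
  simp only [linearField, Finset.sum_mul_sum]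
  rw [integral_finsetSum _ fun k _ => integrable_finsetSum _ fun l _ => hint k l]
  refine Finset.sum_congr rfl fun k _ => ?_
  rw [integral_finsetSum _ fun l _ => hint k l]
  have : ∀ l, ∫ w, a p k * w k * (a q l * w l) ∂stdPi κ =
      a p k * a q l * if k = l then 1 else 0 := by
    intro l
    rw [← integral_eval_mul_eval_stdPi, ← integral_const_mul]
    congr 1
    ext w
    ring
  simp_rw [this]
  simp

variable {n : ℕ}

/-- The two indices of a pair. -/
def Pair.support (p : Pair n) : Finset (Fin n) := {p.1.1, p.1.2}

theorem overlap_self (p : Pair n) : overlap p p = 2 := by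
  rw [overlap, Finset.inter_self, Finset.card_pair p.2.ne]

/-- A pair is recovered from its two-element set by the ordering of its entries. -/
theorem overlap_le_one {p q : Pair n} (h : p ≠ q) : overlap p q ≤ 1 := by
  by_contra! hlt
  have hp : ({p.1.1, p.1.2} : Finset (Fin n)).card = 2 := Finset.card_pair p.2.ne
  have hq : ({q.1.1, q.1.2} : Finset (Fin n)).card = 2 := Finset.card_pair q.2.ne
  have h1 := Finset.eq_of_subset_of_card_le
    (Finset.inter_subset_left (s₁ := {p.1.1, p.1.2}) (s₂ := {q.1.1, q.1.2})) (hp.le.trans hlt)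
  have h2 := Finset.eq_of_subset_of_card_le
    (Finset.inter_subset_right (s₁ := {p.1.1, p.1.2}) (s₂ := {q.1.1, q.1.2})) (hq.le.trans hlt)
  have heq : ({p.1.1, p.1.2} : Finset (Fin n)) = {q.1.1, q.1.2} := h1.symm.trans h2
  have hp2 := p.2
  have hq2 := q.2
  have m1 : p.1.1 ∈ ({q.1.1, q.1.2} : Finset (Fin n)) := heq ▸ by simp
  have m2 : p.1.2 ∈ ({q.1.1, q.1.2} : Finset (Fin n)) := heq ▸ by simp
  simp only [Finset.mem_insert, Finset.mem_singleton] at m1 m2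
  refine h (Subtype.ext (Prod.ext ?_ ?_))
  · rcases m1 with m | m
    · exact m
    · rcases m2 with m' | m' <;> omega
  · rcases m2 with m | m
    · rcases m1 with m' | m' <;> omega
    · exact m

/-- The coefficients of the representation `√r (x_i + x_j) + √(1 - 2r) z_{ij}`. -/
noncomputable def sparseCoeff (r : ℝ) (p : Pair n) : Fin n ⊕ Pair n → ℝ :=
  Sum.elim (fun i => if i ∈ p.support then √r else 0) (fun q => if q = p then √(1 - 2 * r) else 0)

theorem sum_sparseCoeff_mul {r : ℝ} (hr : r ∈ Set.Icc (0 : ℝ) (1 / 2)) (p q : Pair n) :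
    ∑ k, sparseCoeff r p k * sparseCoeff r q k = sparseCov r p q := by
  have hr1 : √r * √r = r := Real.mul_self_sqrt hr.1
  have hr2 : √(1 - 2 * r) * √(1 - 2 * r) = 1 - 2 * r := Real.mul_self_sqrt (by linarith [hr.2])
  have h1 : ∑ i, sparseCoeff r p (Sum.inl i) * sparseCoeff r q (Sum.inl i) = overlap p q * r := by
    have : ∀ i, sparseCoeff r p (Sum.inl i) * sparseCoeff r q (Sum.inl i) =
        if i ∈ p.support ∩ q.support then r else 0 := by
      intro i
      by_cases hp : i ∈ p.support <;> by_cases hq : i ∈ q.support <;>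
        simp [sparseCoeff, hp, hq, hr1]
    simp_rw [this]
    rw [Finset.sum_ite_mem, Finset.univ_inter, Finset.sum_const, nsmul_eq_mul]
    rfl
  have h2 : ∑ s, sparseCoeff r p (Sum.inr s) * sparseCoeff r q (Sum.inr s) =
      if p = q then 1 - 2 * r else 0 := by
    rcases eq_or_ne p q with rfl | h
    · simp [sparseCoeff, hr2]
    · simp [sparseCoeff, h, h.symm]
  rw [Fintype.sum_sum_type, h1, h2, sparseCov]
  by_cases hpq : p = q
  · subst hpq
    simp [overlap_self]
  · have := overlap_le_one hpq
    interval_cases hov : overlap p q <;> simp [hpq]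

/-- The maximum over `i < j` of `√r (x_i + x_j) + √(1 - 2r) z_{ij}`. -/
noncomputable def sparseMax (r : ℝ) (x : Fin n → ℝ) (z : Pair n → ℝ) : ℝ :=
  ⨆ p, (√r * (x p.1.1 + x p.1.2) + √(1 - 2 * r) * z p)

theorem measurable_sparseMax {α : Type*} [MeasurableSpace α] {f : α → Fin n → ℝ}
    {g : α → Pair n → ℝ} (hf : Measurable f) (hg : Measurable g) (r : ℝ) :
    Measurable fun a => sparseMax r (f a) (g a) := by
  unfold sparseMax
  refine Measurable.iSup fun p => ?_
  fun_prop

theorem iSup_linearField (r : ℝ) (w : Fin n ⊕ Pair n → ℝ) :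
    ⨆ p, linearField (sparseCoeff r) p w =
      sparseMax r (fun i => w (Sum.inl i)) (fun p => w (Sum.inr p)) := by
  refine iSup_congr fun p => ?_
  simp only [linearField, Fintype.sum_sum_type, sparseCoeff, Sum.elim_inl, Sum.elim_inr, ite_mul,
    zero_mul]
  congr 1
  · rw [Finset.sum_ite_mem, Finset.univ_inter, Pair.support, Finset.sum_pair p.2.ne, mul_add]
  · simp

theorem IsSparseEquicorrelated.map_fieldMax {Ω : Type*} [MeasurableSpace Ω] {P : Measure Ω}
    [IsProbabilityMeasure P] {r : ℝ} (hr : r ∈ Set.Icc (0 : ℝ) (1 / 2)) {G : Pair n → Ω → ℝ}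
    (hG : IsSparseEquicorrelated G r P) :
    P.map (fieldMax G) =
      ((stdPi (Fin n)).prod (stdPi (Pair n))).map fun w => sparseMax r w.1 w.2 := by
  have hlaw := map_eq_of_hasGaussianLaw hG.gaussian (hasGaussianLaw_linearField (sparseCoeff r))
    hG.centered (integral_linearField _) fun p q => by
      rw [hG.covariance, integral_linearField_mul, sum_sparseCoeff_mul hr]
  have hS : Measurable fun y : Pair n → ℝ => ⨆ p, y p :=
    Measurable.iSup fun p => measurable_pi_apply p
  have hlin : Measurable fun (w : Fin n ⊕ Pair n → ℝ) p => linearField (sparseCoeff r) p w := by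
    unfold linearField
    fun_prop
  have h1 : P.map (fieldMax G) = (P.map fun ω p => G p ω).map fun y => ⨆ p, y p := by
    rw [AEMeasurable.map_map_of_aemeasurable hS.aemeasurable hG.gaussian.aemeasurable]
    rfl
  have hsum := measurePreserving_sumPiEquivProdPi
    (fun _ : Fin n ⊕ Pair n => gaussianReal 0 1)
  rw [h1, hlaw, Measure.map_map hS hlin, ← hsum.map_eq,
    Measure.map_map (measurable_sparseMax measurable_fst measurable_snd r) hsum.measurable]
  congr 1
  ext w
  exact iSup_linearField r w

/-- The action of a permutation of the indices on the pairs. -/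
def Pair.perm (σ : Equiv.Perm (Fin n)) (p : Pair n) : Pair n :=
  if h : σ p.1.1 < σ p.1.2 then ⟨(σ p.1.1, σ p.1.2), h⟩
  else ⟨(σ p.1.2, σ p.1.1), lt_of_le_of_ne (not_lt.1 h) fun h' => p.2.ne (σ.injective h').symm⟩

theorem Pair.perm_perm_symm (σ : Equiv.Perm (Fin n)) (p : Pair n) :
    (p.perm σ).perm σ.symm = p := by
  by_cases h : σ p.1.1 < σ p.1.2
  · have e : p.perm σ = ⟨(σ p.1.1, σ p.1.2), h⟩ := dif_pos h
    rw [e, Pair.perm, dif_pos (by simpa using p.2)]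
    simp
  · have e : p.perm σ = ⟨(σ p.1.2, σ p.1.1), _⟩ := dif_neg h
    rw [e, Pair.perm, dif_neg (by simpa using p.2.le)]
    simp

/-- The action of a permutation of the indices on the pairs, as an equivalence. -/
def Pair.permEquiv (σ : Equiv.Perm (Fin n)) : Equiv.Perm (Pair n) where
  toFun := Pair.perm σ
  invFun := Pair.perm σ.symm
  left_inv := Pair.perm_perm_symm σ
  right_inv p := by simpa using Pair.perm_perm_symm σ.symm p

theorem Pair.add_perm (σ : Equiv.Perm (Fin n)) (x : Fin n → ℝ) (p : Pair n) :
    x (p.perm σ).1.1 + x (p.perm σ).1.2 = x (σ p.1.1) + x (σ p.1.2) := by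
  unfold Pair.perm
  split_ifs with h
  · rfl
  · exact add_comm _ _

theorem sparseMax_comp_perm (r : ℝ) (σ : Equiv.Perm (Fin n)) (x : Fin n → ℝ) (z : Pair n → ℝ) :
    sparseMax r (x ∘ σ) (z ∘ Pair.permEquiv σ) = sparseMax r x z := by
  refine Eq.trans (iSup_congr fun p => ?_) ((Pair.permEquiv σ).iSup_comp
    (g := fun p => √r * (x p.1.1 + x p.1.2) + √(1 - 2 * r) * z p))
  simp only [Function.comp, Pair.permEquiv, Equiv.coe_fn_mk, Pair.add_perm]

theorem measurePreserving_comp_perm {ι : Type*} [Fintype ι] (τ : Equiv.Perm ι) :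
    MeasurePreserving (fun z : ι → ℝ => z ∘ τ) (stdPi ι) (stdPi ι) := by
  have h := measurePreserving_piCongrLeft (α := fun _ => ℝ)
    (fun _ : ι => gaussianReal 0 1) τ.symm
  convert h using 1
  ext z i
  simp [MeasurableEquiv.piCongrLeft, Equiv.piCongrLeft_apply]

/-- Relabelling the pairs preserves the law of `z`. The conditional law of the maximum given `x` is
thus symmetric in `x`, as Rényi's representation requires. -/
theorem stdPi_sparseMax_comp_perm (r : ℝ) (σ : Equiv.Perm (Fin n)) (x : Fin n → ℝ) {A : Set ℝ}
    (hA : MeasurableSet A) :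
    stdPi (Pair n) {z | sparseMax r (x ∘ σ) z ∈ A} = stdPi (Pair n) {z | sparseMax r x z ∈ A} := by
  have hz : Measurable fun z => sparseMax r (x ∘ σ) z :=
    measurable_sparseMax measurable_const measurable_id r
  have hm : MeasurableSet {z | sparseMax r (x ∘ σ) z ∈ A} := hz hA
  rw [← (measurePreserving_comp_perm (Pair.permEquiv σ)).measure_preimage hm.nullMeasurableSet]
  congr 1
  ext z
  change sparseMax r (x ∘ σ) (z ∘ Pair.permEquiv σ) ∈ A ↔ _
  rw [sparseMax_comp_perm]
  rfl

theorem map_sparseMax_eq_renyi (r : ℝ) :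
    ((stdPi (Fin n)).prod (stdPi (Pair n))).map (fun w => sparseMax r w.1 w.2) =
      ((expPi n).prod (stdPi (Pair n))).map
        fun w => sparseMax r (fun i => normalOfExp (renyi n w.1 i)) w.2 := by
  have hq : Measurable fun (e : Fin n → ℝ) i => normalOfExp (e i) := by fun_prop
  have hstd : stdPi (Fin n) = (expPi n).map fun e i => normalOfExp (e i) := by
    have := (Measure.pi_map_pi (μ := fun _ : Fin n => expMeasure 1) (f := fun _ => normalOfExp)
      fun _ => measurable_normalOfExp.aemeasurable).symm
    simpa [map_normalOfExp_expMeasure] using this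
  have hmax : Measurable fun w : (Fin n → ℝ) × (Pair n → ℝ) => sparseMax r w.1 w.2 :=
    measurable_sparseMax measurable_fst measurable_snd r
  have hm1 : Measurable fun w : (Fin n → ℝ) × (Pair n → ℝ) =>
      sparseMax r (fun i => normalOfExp (w.1 i)) w.2 :=
    measurable_sparseMax (hq.comp measurable_fst) measurable_snd r
  have hm2 : Measurable fun w : (Fin n → ℝ) × (Pair n → ℝ) =>
      sparseMax r (fun i => normalOfExp (renyi n w.1 i)) w.2 :=
    measurable_sparseMax (hq.comp ((measurable_renyi n).comp measurable_fst)) measurable_snd r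
  ext A hA
  rw [Measure.map_apply hmax hA, Measure.map_apply hm2 hA, Measure.prod_apply (hmax hA),
    Measure.prod_apply (hm2 hA), hstd, lintegral_map (measurable_measure_prodMk_left (hmax hA)) hq]
  exact (lintegral_expPi_renyi
    (F := fun e => stdPi (Pair n) {z | sparseMax r (fun i => normalOfExp (e i)) z ∈ A})
    (measurable_measure_prodMk_left (hm1 hA))
    fun σ x => stdPi_sparseMax_comp_perm r σ (fun i => normalOfExp (x i)) hA).symm

end FieldLaw

/-! ### Almost sure growth bounds and the coupling. -/

section Assembly

/-- A positive sequence with positive asymptotic lower mean has partial sums of at least linear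
growth. -/
theorem exists_mul_le_sum_range {ζ : ℕ → ℝ} (hζ : ∀ k, 0 < ζ k) {m : ℝ} (hm : 0 < m)
    (h : ∀ᶠ n : ℕ in atTop, m ≤ (∑ k ∈ Finset.range n, ζ k) / n) :
    ∃ κ, 0 < κ ∧ ∀ i : ℕ, κ * (i + 1) ≤ ∑ k ∈ Finset.range (i + 1), ζ k := by
  obtain ⟨N, hN⟩ := eventually_atTop.1 h
  -- For the finitely many short sums, the single term `ζ 0` already suffices.
  refine ⟨min m (ζ 0 / (N + 1)), lt_min hm (div_pos (hζ 0) (by positivity)), fun i => ?_⟩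
  rcases le_or_gt N (i + 1) with hi | hi
  · have := hN (i + 1) hi
    rw [le_div_iff₀ (by positivity)] at this
    push_cast at this
    exact (mul_le_mul_of_nonneg_right (min_le_left _ _) (by positivity)).trans this
  · have hi' : (i : ℝ) + 1 ≤ N + 1 := by exact_mod_cast (by omega : i + 1 ≤ N + 1)
    calc _ ≤ ζ 0 / (N + 1) * (i + 1) :=
          mul_le_mul_of_nonneg_right (min_le_right _ _) (by positivity)
      _ ≤ ζ 0 / (N + 1) * (N + 1) :=
          mul_le_mul_of_nonneg_left hi' (div_pos (hζ 0) (by positivity)).le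
      _ = ζ 0 := by field_simp
      _ ≤ _ := Finset.single_le_sum (f := ζ) (fun k _ => (hζ k).le) (by simp)

theorem summable_exp_neg_logSize : Summable fun p : NatPair => Real.exp (-(2 * logSize p)) := by
  have h1 : Summable fun i : ℕ => (((i : ℝ) + 1) ^ 2)⁻¹ := by
    have := (summable_nat_add_iff 1).2 (Real.summable_nat_pow_inv.2 one_lt_two)
    simpa using this
  have h2 := (h1.mul_of_nonneg h1 (fun i => by positivity) fun i => by positivity).comp_injective
    (Subtype.val_injective (p := fun p : ℕ × ℕ => p.1 < p.2))
  refine h2.congr fun p => ?_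
  have hi : (0 : ℝ) < p.1.1 + 1 := by positivity
  have hj : (0 : ℝ) < p.1.2 + 1 := by positivity
  have : -(2 * logSize p) =
      -(Real.log (((p.1.1 : ℝ) + 1) ^ 2) + Real.log (((p.1.2 : ℝ) + 1) ^ 2)) := by
    rw [logSize, Real.log_pow, Real.log_pow]
    push_cast
    ring
  rw [this, neg_add, Real.exp_add, Real.exp_neg, Real.exp_neg, Real.exp_log (by positivity),
    Real.exp_log (by positivity)]
  rfl

variable {Ω : Type*} [MeasurableSpace Ω] {Q : Measure Ω} {ζ : ℕ → Ω → ℝ} {Z : NatPair → Ω → ℝ}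

theorem ae_pos_of_hasLaw (hζ : ∀ k, HasLaw (ζ k) (expMeasure 1) Q) :
    ∀ᵐ ω ∂Q, ∀ k, 0 < ζ k ω :=
  ae_all_iff.2 fun k =>
    ((hζ k).ae_iff (p := fun e => 0 < e) (measurableSet_Ioi.mem)).2 ae_pos_expMeasure

/-- The strong law is applied to $\min(\zeta_k,1)$, whose integrability is immediate and whose mean
is positive. -/
theorem ae_exists_mul_le_sum_range [IsProbabilityMeasure Q]
    (hζ : ∀ k, HasLaw (ζ k) (expMeasure 1) Q)
    (hindep : iIndepFun ζ Q) :
    ∀ᵐ ω ∂Q, ∃ κ, 0 < κ ∧ ∀ i : ℕ, κ * (i + 1) ≤ ∑ k ∈ Finset.range (i + 1), ζ k ω := by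
  have hmin : Measurable fun x : ℝ => min x 1 := by fun_prop
  have hpos := ae_pos_of_hasLaw hζ
  have hint : Integrable (fun ω => min (ζ 0 ω) 1) Q := by
    refine Integrable.of_bound
      (hmin.comp_aemeasurable (hζ 0).aemeasurable).aestronglyMeasurable 1 ?_
    filter_upwards [hpos] with ω hω
    rw [Real.norm_eq_abs, abs_of_pos (lt_min (hω 0) one_pos)]
    exact min_le_right _ _
  have hmean : 0 < ∫ ω, min (ζ 0 ω) 1 ∂Q := by
    rw [integral_pos_iff_support_of_nonneg_ae _ hint]
    · have : Function.support (fun ω => min (ζ 0 ω) 1) =ᵐ[Q] Set.univ := by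
        filter_upwards [hpos] with ω hω
        exact propext ⟨fun _ => trivial, fun _ => (lt_min (hω 0) one_pos).ne'⟩
      rw [measure_congr this]
      simp
    · filter_upwards [hpos] with ω hω
      exact (lt_min (hω 0) one_pos).le
  have hslln := strong_law_ae_real (μ := Q) (fun k ω => min (ζ k ω) 1) hint
    (fun i j hij => (hindep.indepFun hij).comp hmin hmin)
    (fun i => IdentDistrib.comp ⟨(hζ i).aemeasurable, (hζ 0).aemeasurable,
      (hζ i).map_eq.trans (hζ 0).map_eq.symm⟩ hmin)
  filter_upwards [hpos, hslln] with ω hω hlim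
  refine exists_mul_le_sum_range hω (half_pos hmean) ?_
  filter_upwards [hlim.eventually_const_le (half_lt_self hmean)] with n hn
  exact hn.trans (by gcongr; exact min_le_left _ _)

/-- The sum of $e^{\theta Z_p-2\,\mathrm{logSize}(p)}$ has finite mean, hence is almost surely
finite and bounds each term. Taking logarithms gives slope $2/\theta=\delta$. -/
theorem ae_exists_le_add_mul_logSize_of_pos (hZ : ∀ p, HasLaw (Z p) (gaussianReal 0 1) Q) {δ : ℝ}
    (hδ : 0 < δ) : ∀ᵐ ω ∂Q, ∃ C, ∀ p, Z p ω ≤ C + δ * logSize p := by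
  set θ := 2 / δ with hθ
  have hθ0 : 0 < θ := by positivity
  set f : ℝ → ℝ≥0∞ := fun x => ENNReal.ofReal (Real.exp (θ * x)) with hf
  have hfm : Measurable f := by fun_prop
  have hfin : ∫⁻ x, f x ∂gaussianReal 0 1 ≠ ∞ := by
    have := (integrable_exp_mul_gaussianReal (μ := 0) (v := 1) θ).lintegral_lt_top
    exact this.ne
  have hterm : ∀ p, AEMeasurable
      (fun ω => f (Z p ω) * ENNReal.ofReal (Real.exp (-(2 * logSize p)))) Q := fun p =>
    (hfm.comp_aemeasurable (hZ p).aemeasurable).mul_const _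
  have hsum : ∫⁻ ω, ∑' p, f (Z p ω) * ENNReal.ofReal (Real.exp (-(2 * logSize p))) ∂Q ≠ ∞ := by
    rw [lintegral_tsum hterm]
    have : ∀ p, ∫⁻ ω, f (Z p ω) * ENNReal.ofReal (Real.exp (-(2 * logSize p))) ∂Q =
        (∫⁻ x, f x ∂gaussianReal 0 1) * ENNReal.ofReal (Real.exp (-(2 * logSize p))) := by
      intro p
      rw [lintegral_mul_const'' (f := fun ω => f (Z p ω)) _
          (hfm.comp_aemeasurable (hZ p).aemeasurable),
        (hZ p).lintegral_comp hfm.aemeasurable]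
    simp_rw [this]
    rw [ENNReal.tsum_mul_left]
    exact ENNReal.mul_ne_top hfin summable_exp_neg_logSize.tsum_ofReal_ne_top
  filter_upwards [ae_lt_top' (AEMeasurable.tsum hterm) hsum] with ω hω
  set T := ∑' p, f (Z p ω) * ENNReal.ofReal (Real.exp (-(2 * logSize p))) with hT
  refine ⟨Real.log T.toReal / θ, fun p => ?_⟩
  have hle : ENNReal.ofReal (Real.exp (θ * Z p ω - 2 * logSize p)) ≤ T := by
    rw [sub_eq_add_neg, Real.exp_add, ENNReal.ofReal_mul (Real.exp_pos _).le]
    exact ENNReal.le_tsum p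
  have hle' : Real.exp (θ * Z p ω - 2 * logSize p) ≤ T.toReal :=
    (ENNReal.ofReal_le_iff_le_toReal hω.ne).1 hle
  have hlog := (Real.le_log_iff_exp_le ((Real.exp_pos _).trans_le hle')).2 hle'
  have hδθ : δ = 2 / θ := by rw [hθ]; field_simp
  rw [hδθ, div_mul_eq_mul_div, ← add_div, le_div_iff₀ hθ0]
  linarith

theorem ae_exists_le_add_mul_logSize (hZ : ∀ p, HasLaw (Z p) (gaussianReal 0 1) Q) :
    ∀ᵐ ω ∂Q, ∀ δ > 0, ∃ C, ∀ p, Z p ω ≤ C + δ * logSize p := by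
  -- Countably many slopes suffice, because `logSize` is nonnegative.
  have h : ∀ᵐ ω ∂Q, ∀ m : ℕ, ∃ C, ∀ p, Z p ω ≤ C + 1 / ((m : ℝ) + 1) * logSize p :=
    ae_all_iff.2 fun m => ae_exists_le_add_mul_logSize_of_pos hZ (by positivity)
  filter_upwards [h] with ω hω δ hδ
  obtain ⟨m, hm⟩ := exists_nat_one_div_lt hδ
  obtain ⟨C, hC⟩ := hω m
  exact ⟨C, fun p => (hC p).trans
    (add_le_add_right (mul_le_mul_of_nonneg_right hm.le (logSize_nonneg p)) C)⟩

theorem Pair.toNat_injective {n : ℕ} : Function.Injective (Pair.toNat (n := n)) := by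
  intro p q h
  have h' := congrArg Subtype.val h
  simp only [Pair.toNat, Prod.mk.injEq, Fin.val_inj] at h'
  exact Subtype.ext (Prod.ext h'.1 h'.2)

theorem _root_.ProbabilityTheory.HasLaw.map_measurable {α β : Type*} [MeasurableSpace α]
    [MeasurableSpace β] {μ : Measure α} {X : Ω → α} (hX : HasLaw X μ Q) {f : α → β}
    (hf : Measurable f) : HasLaw (fun ω => f (X ω)) (μ.map f) Q :=
  HasLaw.fun_comp ⟨hf.aemeasurable, rfl⟩ hX

theorem iSup_coupledField (r : ℝ) (ζ : ℕ → ℝ) (z : NatPair → ℝ) (n : ℕ) :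
    ⨆ p : Pair n, coupledField r ζ z n p.toNat =
      sparseMax r (fun i => normalOfExp (renyi n (fun i : Fin n => ζ i) i)) fun p => z p.toNat := by
  refine iSup_congr fun p => ?_
  beta_reduce
  rw [renyi_eq_renyiSeq, renyi_eq_renyiSeq]
  rfl

theorem hasLaw_iSup_coupledField [IsProbabilityMeasure Q]
    (hζ : ∀ k, HasLaw (ζ k) (expMeasure 1) Q)
    (hζ_indep : iIndepFun ζ Q) (hZ : ∀ p, HasLaw (Z p) (gaussianReal 0 1) Q)
    (hZ_indep : iIndepFun Z Q)
    (hζZ : IndepFun (fun ω k => ζ k ω) (fun ω p => Z p ω) Q) (r : ℝ) (n : ℕ) :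
    HasLaw (fun ω => ⨆ p : Pair n, coupledField r (fun k => ζ k ω) (fun p => Z p ω) n p.toNat)
      (((stdPi (Fin n)).prod (stdPi (Pair n))).map fun w => sparseMax r w.1 w.2) Q := by
  have h1 : HasLaw (fun ω (i : Fin n) => ζ i ω) (expPi n) Q :=
    (hζ_indep.precomp Fin.val_injective).hasLaw_pi fun i => hζ i
  have h2 : HasLaw (fun ω (p : Pair n) => Z p.toNat ω) (stdPi (Pair n)) Q :=
    (hZ_indep.precomp Pair.toNat_injective).hasLaw_pi fun p => hZ p.toNat
  have h12 : IndepFun (fun ω (i : Fin n) => ζ i ω) (fun ω (p : Pair n) => Z p.toNat ω) Q :=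
    hζZ.comp (φ := fun (e : ℕ → ℝ) (i : Fin n) => e i)
      (ψ := fun (z : NatPair → ℝ) (p : Pair n) => z p.toNat) (by fun_prop) (by fun_prop)
  have hlaw := h12.hasLaw_prod h1 h2
  have hm : Measurable fun w : (Fin n → ℝ) × (Pair n → ℝ) =>
      sparseMax r (fun i => normalOfExp (renyi n w.1 i)) w.2 :=
    measurable_sparseMax (by fun_prop) measurable_snd r
  have heq : (fun ω => ⨆ p : Pair n, coupledField r (fun k => ζ k ω) (fun p => Z p ω) n p.toNat) =
      fun ω => sparseMax r (fun i => normalOfExp (renyi n (fun i : Fin n => ζ i ω) i))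
        (fun p => Z p.toNat ω) :=
    funext fun ω => iSup_coupledField r (fun k => ζ k ω) (fun p => Z p ω) n
  rw [heq, map_sparseMax_eq_renyi]
  exact hlaw.map_measurable hm

end Assembly

end SparseField

theorem theorem2
    {Ω : ℕ → Type*} [∀ n, MeasurableSpace (Ω n)]
    (P : (n : ℕ) → Measure (Ω n)) [∀ n, IsProbabilityMeasure (P n)]
    (r : ℕ → ℝ) (hr : ∀ n, r n ∈ Set.Icc (0 : ℝ) (1 / 2))
    (G : (n : ℕ) → SparseField.Pair n → Ω n → ℝ)
    (hG : ∀ n, SparseField.IsSparseEquicorrelated (G n) (r n) (P n))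
    (lam : ℝ) (hlam : 0 < lam)
    (hlim : Tendsto (fun n : ℕ => (1 - 2 * r n) * Real.log n) atTop (𝓝 lam))
    {Ω' : Type*} [MeasurableSpace Ω'] (Q : Measure Ω') [IsProbabilityMeasure Q]
    (ζ : ℕ → Ω' → ℝ) (hζ : ∀ k, HasLaw (ζ k) (expMeasure 1) Q) (hζ_indep : iIndepFun ζ Q)
    (Z : SparseField.NatPair → Ω' → ℝ) (hZ : ∀ p, HasLaw (Z p) (gaussianReal 0 1) Q)
    (hZ_indep : iIndepFun Z Q)
    (hζZ : IndepFun (fun ω k => ζ k ω) (fun ω p => Z p ω) Q) :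
    (∀ᵐ ω ∂Q, BddAbove (Set.range fun p => SparseField.perturbed lam ζ Z p ω)) ∧
    TendstoInDistribution
      (fun n ω => SparseField.cSeq n * (SparseField.fieldMax (G n) ω - √2 * SparseField.dSeq n))
      atTop
      (fun ω => (⨆ p, SparseField.perturbed lam ζ Z p ω) - √2 * lam)
      P Q := by
  let H : ℕ → Ω' → ℝ := fun n ω => ⨆ p : SparseField.Pair n,
    SparseField.coupledField (r n) (fun k => ζ k ω) (fun p => Z p ω) n p.toNat
  let A : ℕ → ℝ → ℝ := fun n x => SparseField.cSeq n * (x - √2 * SparseField.dSeq n)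
  have hA : ∀ n, Measurable (A n) := fun n => by fun_prop
  -- `H n` copies the law of the maximum onto the space carrying the limit.
  have hH : ∀ n, HasLaw (H n) ((P n).map (SparseField.fieldMax (G n))) Q := fun n => by
    rw [(hG n).map_fieldMax (hr n)]
    exact SparseField.hasLaw_iSup_coupledField hζ hζ_indep hZ hZ_indep hζZ (r n) n
  have hG_meas : ∀ n, AEMeasurable (SparseField.fieldMax (G n)) (P n) := fun n =>
    (Measurable.iSup fun p => measurable_pi_apply p : Measurable
      fun y : SparseField.Pair n → ℝ => ⨆ p, y p).comp_aemeasurable (hG n).gaussian.aemeasurable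
  have hpath : ∀ᵐ ω ∂Q, BddAbove (Set.range fun p => SparseField.perturbed lam ζ Z p ω) ∧
      Tendsto (fun n => A n (H n ω)) atTop
        (𝓝 ((⨆ p, SparseField.perturbed lam ζ Z p ω) - √2 * lam)) := by
    filter_upwards [SparseField.ae_pos_of_hasLaw hζ,
      SparseField.ae_exists_mul_le_sum_range hζ hζ_indep,
      SparseField.ae_exists_le_add_mul_logSize hZ] with ω hpos ⟨κ, hκ, hsum⟩ hz
    exact SparseField.tendsto_iSup_coupledField hr hlim hpos hκ hsum hz fun p => rfl
  have hAH : ∀ n, AEMeasurable (fun ω => A n (H n ω)) Q := fun n =>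
    (hA n).comp_aemeasurable (hH n).aemeasurable
  have hdist := tendstoInDistribution_of_ae_tendsto hAH
    (aemeasurable_of_tendsto_metrizable_ae atTop hAH (hpath.mono fun _ h => h.2))
    (hpath.mono fun _ h => h.2)
  have hmap : ∀ n, (P n).map (fun ω => A n (SparseField.fieldMax (G n) ω)) =
      Q.map fun ω => A n (H n ω) := fun n => by
    have h1 := AEMeasurable.map_map_of_aemeasurable (hA n).aemeasurable (hG_meas n)
    have h2 := AEMeasurable.map_map_of_aemeasurable (hA n).aemeasurable (hH n).aemeasurable
    rw [(hH n).map_eq] at h2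
    exact h1.symm.trans h2
  refine ⟨hpath.mono fun _ h => h.1,
    ⟨fun n => (hA n).comp_aemeasurable (hG_meas n), hdist.aemeasurable_limit, ?_⟩⟩
  -- Convergence in distribution sees only the laws, which agree for every `n`.
  refine hdist.tendsto.congr fun n => ?_
  exact Subtype.ext (hmap n).symm
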